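/- Let $d\ge 1$ and let $|\cdot|$ be any norm on $\mathbb{R}^d$ (equivalently, work in any $d$-dimensional real normed space). Let $B(0,1)$ be the open unit ball. Assume that there are constants $A,D>0$ and $r>1$ such that for each $k\ge 1$ there is a family $(\mathcal Q_{k,\ell})_{\ell=0,\dots,k}$ of nested Borel partitions of $B(0,1)$ (each $\mathcal Q_{k,\ell+1}$ refines $\mathcal Q_{k,\ell}$) with $\mathcal Q_{k,0}=\{B(0,1)\}$, with $|\mathcal Q_{k,\ell}|\le A\,r^{d\ell}$ for $\ell=1,\dots,k$, and with $\sup_{x,y\in C}|x-y|\le D\,r^{-\ell}$ for all $\ell=0,\dots,k$ and all $C\in\mathcal Q_{k,\ell}$. For $p,q>0$ and probability measures $\mu,\nu$ on $\mathbb{R}^d$, let $\mathcal T_p(\mu,\nu)=\inf_\xi\int|x-y|^p\,\xi(dx,dy)$, the infimum being over all couplings $\xi$ of $\mu$ and $\nu$, and $\mathcal M_q(\mu)=\int|x|^q\mu(dx)$. Put $\varepsilon_p=\max\{2^{-1},2^{-p}\}$, $\log_+x=\max\{\log x,0\}$ and, for $x>0$ and $q>s>0$, $$H(x,s,q)=\Big(x\frac{q-s}{s}+(1+x)\Big(\frac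 qs\Big)^{q/(q-s)}\Big)^{s/q}\frac q{q-s}.$$ Let $\mu$ be a probability measure on $\mathbb{R}^d$, let $(X_k)_{k\ge1}$ be an i.i.d. sequence of $\mu$-distributed random variables, and let $\mu_N=\frac1N\sum_{k=1}^N\delta_{X_k}$. Let $q>p>0$ with $\mathcal M_q(\mu)<\infty$. Then $\mathcal T_p(\mu_N,\mu)$ is (almost everywhere) measurable for each $N\ge1$, and the following hold. (i) If $p>d/2$ and $q>2p$, then for all $N\ge1$, $$\mathbb E[\mathcal T_p(\mu_N,\mu)]\le 2^p\frac{\kappa}{\sqrt N}[\mathcal M_q(\mu)]^{p/q}H\Big(\frac{\varepsilon_p}{\kappa},2p,q\Big),\qquad \kappa=\frac{D^p\sqrt{Ar^d}}{2^{p+1}(1-r^{d/2-p})}.$$ (ii) If $p=d/2$ and $q>2p$, then for all $N\ge1$, $$\mathbb E[\mathcal T_p(\mu_N,\mu)]\le 2^p\frac{\kappa_N}{\sqrt N}[\mathcal M_q(\mu)]^{p/q}H\Big(\frac{\varepsilon_p}{\kappa_N},2p,q\Big),$$ $$\kappa_N=\frac{D^p\sqrt A\,r^p}{2^{p+1}p\log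 r}\log_+\Big(2(r^{-p}-r^{-2p})\sqrt{\frac NA}\Big)+\frac{D^p\sqrt A\,r^{2p}}{2^{p+1}(r^p-1)}.$$ (iii) If $p\in(0,d/2)$ and $q>dp/(d-p)$, then for all $N\ge1$, $$\mathbb E[\mathcal T_p(\mu_N,\mu)]\le 2^p\frac{\kappa}{N^{p/d}}[\mathcal M_q(\mu)]^{p/q}H\Big(\frac{2^{1-2p/d}\varepsilon_p}{\kappa},\frac{dp}{d-p},q\Big),\qquad \kappa=\frac{D^pA^{p/d}r^p(r^{d/2}-1)^{1-2p/d}}{2^{p+2p/d}(r^{d/2-p}-1)}.$$ -/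

import Mathlib

open MeasureTheory ProbabilityTheory
open scoped ENNReal

noncomputable section

/-- The set of couplings of `μ` and `ν`: measures on the product with marginals `μ` and `ν`.
When `μ` and `ν` are probability measures, so is every coupling. -/
def couplings {E : Type*} [MeasurableSpace E] (μ ν : Measure E) : Set (Measure (E × E)) :=
  {ξ | ξ.map Prod.fst = μ ∧ ξ.map Prod.snd = ν}

/-- The transport cost `T_p(μ, ν) = inf_ξ ∫ ‖x - y‖ ^ p ξ(dx, dy)`, the infimum being over the
couplings `ξ` of `μ` and `ν`, with values in `[0, ∞]`. -/
def transportCost {E : Type*} [NormedAddCommGroup E] [MeasurableSpace E]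
    (p : ℝ) (μ ν : Measure E) : ℝ≥0∞ :=
  ⨅ ξ ∈ couplings μ ν, ∫⁻ z, ENNReal.ofReal (‖z.1 - z.2‖ ^ p) ∂ξ

/-- The moment `M_q(μ) = ∫ ‖x‖ ^ q μ(dx)`, with values in `[0, ∞]`. -/
def absMoment {E : Type*} [NormedAddCommGroup E] [MeasurableSpace E]
    (q : ℝ) (μ : Measure E) : ℝ≥0∞ :=
  ∫⁻ x, ENNReal.ofReal (‖x‖ ^ q) ∂μ

/-- The empirical measure `(1/N) ∑_{k < N} δ_{x k}` of the first `N` terms of a sequence. -/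
def empiricalMeasure {E : Type*} [MeasurableSpace E] (N : ℕ) (x : ℕ → E) : Measure E :=
  (N : ℝ≥0∞)⁻¹ • ∑ k ∈ Finset.range N, Measure.dirac (x k)

/-- For every `k ≥ 1` there are nested Borel partitions `Q 0, …, Q k` of the open unit ball of `E`,
starting with the trivial partition, such that `Q ℓ` has at most `A r ^ (d ℓ)` cells (`1 ≤ ℓ ≤ k`),
all of them of diameter at most `D r ^ (-ℓ)` (`0 ≤ ℓ ≤ k`).  (On finite partitions, `P ≤ Q` means
that `P` refines `Q`; the cells of a `Finpartition` are nonempty and pairwise disjoint.) -/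
def HasNestedPartitions (E : Type*) [NormedAddCommGroup E] [MeasurableSpace E]
    (d : ℕ) (A D r : ℝ) : Prop :=
  ∀ k : ℕ, 1 ≤ k → ∃ Q : ℕ → Finpartition (Metric.ball (0 : E) 1),
    (Q 0).parts = {Metric.ball (0 : E) 1} ∧
    (∀ ℓ, ℓ < k → Q (ℓ + 1) ≤ Q ℓ) ∧
    (∀ ℓ, ℓ ≤ k → ∀ C ∈ (Q ℓ).parts, MeasurableSet C) ∧
    (∀ ℓ, 1 ≤ ℓ → ℓ ≤ k → ((Q ℓ).parts.card : ℝ) ≤ A * r ^ (d * ℓ)) ∧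
    (∀ ℓ, ℓ ≤ k → ∀ C ∈ (Q ℓ).parts, ∀ x ∈ C, ∀ y ∈ C, ‖x - y‖ ≤ D * (r ^ ℓ)⁻¹)

/-- `H(x, s, q)`, for `x > 0` and `q > s > 0`. -/
def constH (x s q : ℝ) : ℝ :=
  (x * ((q - s) / s) + (1 + x) * (q / s) ^ (q / (q - s))) ^ (s / q) * (q / (q - s))

/-- `ε_p = max {1/2, 2 ^ (-p)}`. -/
def epsConst (p : ℝ) : ℝ := max (1 / 2) ((2 : ℝ) ^ (-p))

/-- The constant `κ` in the regime `p > d/2`. -/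
def kappaHigh (d : ℕ) (A D r p : ℝ) : ℝ :=
  D ^ p * √(A * r ^ d) / ((2 : ℝ) ^ (p + 1) * (1 - r ^ ((d : ℝ) / 2 - p)))

/-- The constant `κ` in the regime `p = d/2`; here `Real.posLog x = max 0 (log x)`. -/
def kappaCritical (A D r p : ℝ) (N : ℕ) : ℝ :=
  D ^ p * √A * r ^ p / ((2 : ℝ) ^ (p + 1) * p * Real.log r)
      * Real.posLog (2 * (r ^ (-p) - r ^ (-(2 * p))) * √((N : ℝ) / A))
    + D ^ p * √A * r ^ (2 * p) / ((2 : ℝ) ^ (p + 1) * (r ^ p - 1))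

/-- The constant `κ` in the regime `p < d/2`. -/
def kappaLow (d : ℕ) (A D r p : ℝ) : ℝ :=
  D ^ p * A ^ (p / d) * r ^ p * (r ^ ((d : ℝ) / 2) - 1) ^ (1 - 2 * p / d)
    / ((2 : ℝ) ^ (p + 2 * p / d) * (r ^ ((d : ℝ) / 2 - p) - 1))

end

/-! ### Partial couplings -/

section PartialCouplings

variable {E : Type*} [MeasurableSpace E]

/-! Space is cut into a ball and concentric shells whose radii grow geometrically. Inside each shell
`G`, with `α` the empirical measure and `β = μ`, mass is matched greedily along rescaled nested
partitions, from the finest level to the coarsest. After level `ℓ` every cell `C` of that level has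
matched mass `min (α C) (β C)`, so the mass first matched at level `ℓ` is the drop of `∑ min (α C)
(β C)` between levels `ℓ + 1` and `ℓ`, and its cost per unit is the `p`-th power of a level-`ℓ`
diameter (`exists_partialCoupling_of_nested`). Abel summation expresses the cost through the
deficits of these sums, each at most half of `∑ |α C - β C|`. Mass left over by the shells is
coupled arbitrarily, at a price proportional to the fluctuations of the shell masses
(`transportCost_le_tsum`).

In expectation, a set of mass `u` fluctuates by at most `min (2u) √(u/N)`, and Cauchy-Schwarz over
the cells of a partition brings in the square root of their number. The geometric growth of the
partitions then competes with the factor `r ^ (-pℓ)`. Choosing the depth according to the mass `u`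
of the shell bounds its cost by a constant times `u ^ (p/s)`, with `s = 2p` or `s = dp/(d-p)`; the
lemmas `exists_depth_of_lt`, `exists_depth_of_eq` and `exists_depth_of_gt` treat the three regimes.

Markov's inequality makes the shell masses decay geometrically, so the costs sum to a geometric
series when `q > s`. The ratio of the radii is optimised in `lintegral_transportCost_le_radius` and
the radius of the central ball in `le_of_forall_radius`; these two optimisations produce `constH`.

Measurability comes from disintegration: the cost is an infimum of continuous functions of the
sample points, hence upper semicontinuous. -/

/-- A partial coupling of `α` and `β`: a measure whose marginals are dominated by `α` and `β`. -/
def IsPartialCoupling (α β : Measure E) (ξ : Measure (E × E)) : Prop :=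
  ξ.map Prod.fst ≤ α ∧ ξ.map Prod.snd ≤ β

/-- The normalised product of the restrictions of `α` and `β` to a cell `C`. -/
noncomputable def blockCoupling (α β : Measure E) (C : Set E) : Measure (E × E) :=
  (max (α C) (β C))⁻¹ • (α.restrict C).prod (β.restrict C)

lemma ENNReal.max_inv_mul_mul_eq_min {a b : ℝ≥0∞} (ha : a ≠ ∞) (hb : b ≠ ∞) :
    (max a b)⁻¹ * (b * a) = min a b := by
  rcases le_total a b with h | h
  · rw [max_eq_right h, min_eq_left h]
    rcases eq_or_ne b 0 with rfl | hb0
    · simp at h; simp [h]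
    · rw [← mul_assoc, ENNReal.inv_mul_cancel hb0 hb, one_mul]
  · rw [max_eq_left h, min_eq_right h]
    rcases eq_or_ne a 0 with rfl | ha0
    · simp at h; simp [h]
    · rw [mul_comm b a, ← mul_assoc, ENNReal.inv_mul_cancel ha0 ha, one_mul]

lemma blockCoupling_map_fst (α β : Measure E) [IsFiniteMeasure α] [IsFiniteMeasure β] (C : Set E) :
    (blockCoupling α β C).map Prod.fst = ((max (α C) (β C))⁻¹ * β C) • α.restrict C := by
  rw [blockCoupling, Measure.map_smul, Measure.map_fst_prod, smul_smul,
    Measure.restrict_apply_univ]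

lemma blockCoupling_map_snd (α β : Measure E) [IsFiniteMeasure α] [IsFiniteMeasure β] (C : Set E) :
    (blockCoupling α β C).map Prod.snd = ((max (α C) (β C))⁻¹ * α C) • β.restrict C := by
  rw [blockCoupling, Measure.map_smul, Measure.map_snd_prod, smul_smul,
    Measure.restrict_apply_univ]

lemma ENNReal.inv_mul_le_one_of_le {a b : ℝ≥0∞} (h : a ≤ b) : b⁻¹ * a ≤ 1 := by
  calc b⁻¹ * a ≤ b⁻¹ * b := by gcongr
    _ ≤ 1 := ENNReal.inv_mul_le_one b

lemma blockCoupling_map_fst_le (α β : Measure E) [IsFiniteMeasure α] [IsFiniteMeasure β]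
    (C : Set E) : (blockCoupling α β C).map Prod.fst ≤ α.restrict C := by
  rw [blockCoupling_map_fst]
  calc _ ≤ (1 : ℝ≥0∞) • α.restrict C := by
        gcongr
        exact ENNReal.inv_mul_le_one_of_le (le_max_right _ _)
    _ = _ := one_smul _ _

lemma blockCoupling_map_snd_le (α β : Measure E) [IsFiniteMeasure α] [IsFiniteMeasure β]
    (C : Set E) : (blockCoupling α β C).map Prod.snd ≤ β.restrict C := by
  rw [blockCoupling_map_snd]
  calc _ ≤ (1 : ℝ≥0∞) • β.restrict C := by
        gcongr
        exact ENNReal.inv_mul_le_one_of_le (le_max_left _ _)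
    _ = _ := one_smul _ _

/-- Normalising by the larger of the two masses keeps both marginals dominated while moving the
smaller mass in full, which is the most that can be matched inside the cell. -/
lemma blockCoupling_univ (α β : Measure E) [IsFiniteMeasure α] [IsFiniteMeasure β] (C : Set E) :
    blockCoupling α β C Set.univ = min (α C) (β C) := by
  rw [blockCoupling, Measure.smul_apply, ← Set.univ_prod_univ, Measure.prod_prod,
    Measure.restrict_apply_univ, Measure.restrict_apply_univ, smul_eq_mul, mul_comm (α C),
    ENNReal.max_inv_mul_mul_eq_min (measure_ne_top _ _) (measure_ne_top _ _)]

lemma ae_blockCoupling (α β : Measure E) [IsFiniteMeasure α] [IsFiniteMeasure β] {C : Set E}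
    (hC : MeasurableSet C) : ∀ᵐ z ∂blockCoupling α β C, z.1 ∈ C ∧ z.2 ∈ C := by
  refine Measure.ae_smul_measure ?_ _
  rw [Measure.prod_restrict]
  exact ae_restrict_mem (hC.prod hC)

lemma map_fst_univ (ξ : Measure (E × E)) : ξ.map Prod.fst Set.univ = ξ Set.univ := by
  rw [Measure.map_apply measurable_fst MeasurableSet.univ, Set.preimage_univ]

lemma map_snd_univ (ξ : Measure (E × E)) : ξ.map Prod.snd Set.univ = ξ Set.univ := by
  rw [Measure.map_apply measurable_snd MeasurableSet.univ, Set.preimage_univ]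

lemma sum_restrict_le {ι : Type*} (α : Measure E) (S : Finset ι) (c : ι → Set E)
    (hm : ∀ i ∈ S, MeasurableSet (c i)) (hd : (S : Set ι).PairwiseDisjoint c) :
    ∑ i ∈ S, α.restrict (c i) ≤ α := by
  refine Measure.le_iff.2 fun s hs => ?_
  rw [Measure.finsetSum_apply]
  calc ∑ i ∈ S, α.restrict (c i) s = ∑ i ∈ S, α (s ∩ c i) :=
        Finset.sum_congr rfl fun i _ => Measure.restrict_apply hs
    _ = α (⋃ i ∈ S, s ∩ c i) := by
        rw [measure_biUnion_finset]
        · exact fun i hi j hj hij => (hd hi hj hij).mono Set.inter_subset_right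
            Set.inter_subset_right
        · exact fun i hi => hs.inter (hm i hi)
    _ ≤ α s := measure_mono (Set.iUnion₂_subset fun i _ => Set.inter_subset_left)

/-- If the two marginals of a partial coupling agree on a cell then the coupling can be extended
inside disjoint cells so that each of them is saturated. -/
lemma IsPartialCoupling.exists_extension {ι : Type*} {α β : Measure E} [IsFiniteMeasure α]
    [IsFiniteMeasure β] {ξ : Measure (E × E)} (hξ : IsPartialCoupling α β ξ) (S : Finset ι)
    (c : ι → Set E) (hm : ∀ i ∈ S, MeasurableSet (c i)) (hd : (S : Set ι).PairwiseDisjoint c)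
    (hsym : ∀ i ∈ S, ξ.map Prod.fst (c i) = ξ.map Prod.snd (c i)) :
    ∃ η : Measure (E × E), IsPartialCoupling α β (ξ + η) ∧
      (∀ᵐ z ∂η, ∃ i ∈ S, z.1 ∈ c i ∧ z.2 ∈ c i) ∧
      η Set.univ + ∑ i ∈ S, ξ.map Prod.fst (c i) = ∑ i ∈ S, min (α (c i)) (β (c i)) := by
  have : IsFiniteMeasure (ξ.map Prod.fst) := isFiniteMeasure_of_le α hξ.1
  have : IsFiniteMeasure (ξ.map Prod.snd) := isFiniteMeasure_of_le β hξ.2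
  set a := α - ξ.map Prod.fst
  set b := β - ξ.map Prod.snd
  -- Only the residual measures `a` and `b`, not yet used by `ξ`, are coupled inside the cells.
  refine ⟨∑ i ∈ S, blockCoupling a b (c i), ⟨?_, ?_⟩, ?_, ?_⟩
  · rw [Measure.map_add _ _ measurable_fst, ← Measure.sub_add_cancel_of_le hξ.1, add_comm]
    refine add_le_add_left ?_ _
    rw [← Measure.mapₗ_apply_of_measurable measurable_fst, map_sum]
    refine le_trans (Finset.sum_le_sum fun i _ => ?_) (sum_restrict_le a S c hm hd)
    rw [Measure.mapₗ_apply_of_measurable measurable_fst]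
    exact blockCoupling_map_fst_le _ _ _
  · rw [Measure.map_add _ _ measurable_snd, ← Measure.sub_add_cancel_of_le hξ.2, add_comm]
    refine add_le_add_left ?_ _
    rw [← Measure.mapₗ_apply_of_measurable measurable_snd, map_sum]
    refine le_trans (Finset.sum_le_sum fun i _ => ?_) (sum_restrict_le b S c hm hd)
    rw [Measure.mapₗ_apply_of_measurable measurable_snd]
    exact blockCoupling_map_snd_le _ _ _
  · rw [← Measure.sum_coe_finset, Measure.ae_sum_iff]
    rintro ⟨i, hi⟩
    filter_upwards [ae_blockCoupling a b (hm i hi)] with z hz using ⟨i, hi, hz⟩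
  · rw [Measure.finsetSum_apply, ← Finset.sum_add_distrib]
    refine Finset.sum_congr rfl fun i hi => ?_
    -- Both marginals of `ξ` give the cell the same mass, so adding it to the minimum of the
    -- residual masses restores the minimum of the original ones.
    rw [blockCoupling_univ, Measure.sub_apply (hm i hi) hξ.1, Measure.sub_apply (hm i hi) hξ.2,
      ← hsym i hi, ← min_add_add_right, tsub_add_cancel_of_le (hξ.1 _), tsub_add_cancel_of_le]
    rw [hsym i hi]
    exact hξ.2 _

lemma map_fst_eq_map_snd_of_ae {ξ : Measure (E × E)} {C : Set E} (hC : MeasurableSet C)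
    (h : ∀ᵐ z ∂ξ, z.1 ∈ C ↔ z.2 ∈ C) : ξ.map Prod.fst C = ξ.map Prod.snd C := by
  rw [Measure.map_apply measurable_fst hC, Measure.map_apply measurable_snd hC]
  refine measure_congr ?_
  filter_upwards [h] with z hz using propext hz

omit [MeasurableSpace E] in
-- A coarse cell cannot separate two points of one fine cell. A coupling carried by fine cells
-- therefore has marginals agreeing on coarse cells, as `IsPartialCoupling.exists_extension`
-- requires.
lemma mem_iff_of_subset_or_disjoint {ι : Type*} {S T : Finset ι} {c : ι → Set E}
    (hd : (S : Set ι).PairwiseDisjoint c) (href : ∀ i ∈ T, ∃ j ∈ S, c i ⊆ c j) {x y : E}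
    (h : ∃ i ∈ T, x ∈ c i ∧ y ∈ c i) {j : ι} (hj : j ∈ S) : x ∈ c j ↔ y ∈ c j := by
  obtain ⟨i, hi, hx, hy⟩ := h
  obtain ⟨l, hl, hil⟩ := href i hi
  by_cases hjl : j = l
  · subst hjl
    exact ⟨fun _ => hil hy, fun _ => hil hx⟩
  · have := Set.disjoint_left.1 (hd hj hl hjl)
    exact ⟨fun h => (this h (hil hx)).elim, fun h => (this h (hil hy)).elim⟩

lemma sum_map_fst_eq_univ {ι : Type*} {S : Finset ι} {c : ι → Set E} {ξ : Measure (E × E)}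
    (hm : ∀ i ∈ S, MeasurableSet (c i)) (hd : (S : Set ι).PairwiseDisjoint c)
    (h : ∀ᵐ z ∂ξ, ∃ i ∈ S, z.1 ∈ c i) : ∑ i ∈ S, ξ.map Prod.fst (c i) = ξ Set.univ := by
  rw [← measure_biUnion_finset hd hm,
    Measure.map_apply measurable_fst (S.measurableSet_biUnion hm)]
  refine measure_congr ?_
  filter_upwards [h] with z hz
  refine propext ⟨fun _ => trivial, fun _ => ?_⟩
  obtain ⟨i, hi, hz⟩ := hz
  exact Set.mem_biUnion (s := (S : Set ι)) (t := c) hi hz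

/-- The greedy coupling along a finite sequence of nested families of cells, from the finest family
to the coarsest one. -/
lemma exists_partialCoupling_of_nested {ι : Type*} (α β : Measure E) [IsFiniteMeasure α]
    [IsFiniteMeasure β] (c : ι → Set E) (f : E × E → ℝ≥0∞) (k : ℕ) (S : ℕ → Finset ι)
    (w : ℕ → ℝ≥0∞)
    (hm : ∀ ℓ ≤ k, ∀ i ∈ S ℓ, MeasurableSet (c i))
    (hd : ∀ ℓ ≤ k, (S ℓ : Set ι).PairwiseDisjoint c)
    (href : ∀ ℓ < k, ∀ i ∈ S (ℓ + 1), ∃ j ∈ S ℓ, c i ⊆ c j)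
    (hw : ∀ ℓ ≤ k, ∀ i ∈ S ℓ, ∀ x ∈ c i, ∀ y ∈ c i, f (x, y) ≤ w ℓ) :
    ∃ ξ : Measure (E × E), IsPartialCoupling α β ξ ∧
      (∀ᵐ z ∂ξ, ∃ i ∈ S 0, z.1 ∈ c i ∧ z.2 ∈ c i) ∧
      ξ Set.univ = ∑ i ∈ S 0, min (α (c i)) (β (c i)) ∧
      ∃ v : ℕ → ℝ≥0∞, (∀ ℓ < k, v ℓ + ∑ i ∈ S (ℓ + 1), min (α (c i)) (β (c i)) =
          ∑ i ∈ S ℓ, min (α (c i)) (β (c i))) ∧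
        v k = ∑ i ∈ S k, min (α (c i)) (β (c i)) ∧
        ∫⁻ z, f z ∂ξ ≤ ∑ ℓ ∈ Finset.range (k + 1), w ℓ * v ℓ := by
  induction k generalizing S w with
  | zero =>
    have h0 : IsPartialCoupling α β (0 : Measure (E × E)) := by
      constructor <;> simp [Measure.zero_le]
    obtain ⟨η, h1, h2, h3⟩ := h0.exists_extension (S 0) c (hm 0 le_rfl) (hd 0 le_rfl) (by simp)
    simp only [zero_add, Measure.map_zero, Measure.coe_zero, Pi.zero_apply, Finset.sum_const_zero,
      add_zero] at h1 h3
    refine ⟨η, h1, h2, h3, fun _ => ∑ i ∈ S 0, min (α (c i)) (β (c i)), by simp, rfl, ?_⟩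
    simp only [zero_add, Finset.range_one, Finset.sum_singleton]
    rw [← h3, ← lintegral_const]
    refine lintegral_mono_ae ?_
    filter_upwards [h2] with z ⟨i, hi, hz1, hz2⟩ using hw 0 le_rfl i hi _ hz1 _ hz2
  | succ k ih =>
    -- The induction strips off the coarsest level: the shifted families yield the coupling of all
    -- finer levels, and one extension inside the cells of `S 0` remains.
    obtain ⟨ξ, h1, h2, h3, v, h4, h5, h6⟩ := ih (fun ℓ => S (ℓ + 1)) (fun ℓ => w (ℓ + 1))
      (fun ℓ hℓ => hm _ (by omega)) (fun ℓ hℓ => hd _ (by omega)) (fun ℓ hℓ => href _ (by omega))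
      (fun ℓ hℓ => hw _ (by omega))
    have hd0 := hd 0 (Nat.zero_le _)
    have hm0 := hm 0 (Nat.zero_le _)
    have href0 := href 0 (Nat.succ_pos _)
    obtain ⟨η, g1, g2, g3⟩ := h1.exists_extension (S 0) c hm0 hd0 (fun j hj =>
      map_fst_eq_map_snd_of_ae (hm0 j hj) (h2.mono fun z hz =>
        mem_iff_of_subset_or_disjoint hd0 href0 hz hj))
    have h2' : ∀ᵐ z ∂ξ, ∃ i ∈ S 0, z.1 ∈ c i ∧ z.2 ∈ c i := by
      filter_upwards [h2] with z ⟨i, hi, hz1, hz2⟩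
      obtain ⟨j, hj, hij⟩ := href0 i hi
      exact ⟨j, hj, hij hz1, hij hz2⟩
    rw [sum_map_fst_eq_univ hm0 hd0 (h2'.mono fun z ⟨i, hi, hz⟩ => ⟨i, hi, hz.1⟩)] at g3
    -- `v ℓ` is the mass added at level `ℓ`; at the finest level it is everything matched there.
    refine ⟨ξ + η, g1, ?_, ?_, fun ℓ => Nat.casesOn ℓ (η Set.univ) v, ?_, ?_, ?_⟩
    · rw [ae_add_measure_iff]
      exact ⟨h2', g2⟩
    · rw [Measure.add_apply, add_comm, g3]
    · rintro (_ | ℓ) hℓ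
      · rw [h3] at g3
        exact g3
      · exact h4 ℓ (by omega)
    · exact h5
    · rw [lintegral_add_measure, Finset.sum_range_succ']
      refine add_le_add h6 ?_
      change _ ≤ w 0 * η Set.univ
      rw [← lintegral_const]
      refine lintegral_mono_ae ?_
      filter_upwards [g2] with z ⟨i, hi, hz1, hz2⟩ using hw 0 (Nat.zero_le _) i hi _ hz1 _ hz2

end PartialCouplings

/-! ### Gluing over countably many shells -/

section Gluing

variable {E : Type*} [MeasurableSpace E]

lemma map_fst_apply_eq_zero {ξ : Measure (E × E)} {C G : Set E} (hC : MeasurableSet C)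
    (h : ∀ᵐ z ∂ξ, z.1 ∈ G ∧ z.2 ∈ G) (hd : Disjoint C G) : ξ.map Prod.fst C = 0 := by
  rw [Measure.map_apply measurable_fst hC, measure_eq_zero_iff_ae_notMem]
  filter_upwards [h] with z hz hzC using Set.disjoint_left.1 hd hzC hz.1

/-- The pieces live on disjoint shells, so on a set `s` the `n`-th one uses only the mass of `s ∩ G
n`, and these masses add up to at most that of `s`. -/
lemma IsPartialCoupling.sum {α β : Measure E} {G : ℕ → Set E} (hG : ∀ n, MeasurableSet (G n))
    (hGd : Pairwise (Function.onFun Disjoint G)) {ξ : ℕ → Measure (E × E)}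
    (hξ : ∀ n, IsPartialCoupling α β (ξ n)) (hξG : ∀ n, ∀ᵐ z ∂ξ n, z.1 ∈ G n ∧ z.2 ∈ G n) :
    IsPartialCoupling α β (Measure.sum ξ) := by
  have key : ∀ (γ : Measure E) (g : E × E → E), Measurable g → (∀ n, (ξ n).map g ≤ γ) →
      (∀ n, ∀ᵐ z ∂ξ n, g z ∈ G n) → (Measure.sum ξ).map g ≤ γ := by
    intro γ g hg h1 h2
    refine Measure.le_iff.2 fun s hs => ?_
    rw [Measure.map_apply hg hs, Measure.sum_apply _ (hg hs)]
    calc ∑' n, ξ n (g ⁻¹' s) ≤ ∑' n, γ (s ∩ G n) := by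
          refine ENNReal.tsum_le_tsum fun n => ?_
          refine le_trans (le_of_eq ?_) (h1 n (s ∩ G n))
          rw [Measure.map_apply hg (hs.inter (hG n))]
          refine measure_congr ?_
          filter_upwards [h2 n] with z hz
          exact propext ⟨fun h => ⟨h, hz⟩, fun h => h.1⟩
      _ = γ (⋃ n, s ∩ G n) := by
          rw [measure_iUnion]
          · exact fun i j hij => (hGd hij).mono Set.inter_subset_right Set.inter_subset_right
          · exact fun n => hs.inter (hG n)
      _ ≤ γ s := measure_mono (Set.iUnion_subset fun n => Set.inter_subset_left)
  exact ⟨key α _ measurable_fst (fun n => (hξ n).1) fun n => (hξG n).mono fun z hz => hz.1,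
    key β _ measurable_snd (fun n => (hξ n).2) fun n => (hξG n).mono fun z hz => hz.2⟩

lemma sub_min_add_sub_min_eq_ofReal_abs (α β : Measure E) [IsFiniteMeasure α] [IsFiniteMeasure β]
    (C : Set E) : (α C - min (α C) (β C)) + (β C - min (α C) (β C))
      = ENNReal.ofReal |α.real C - β.real C| := by
  rw [← ENNReal.ofReal_toReal (measure_ne_top α C), ← ENNReal.ofReal_toReal (measure_ne_top β C),
    ← measureReal_def, ← measureReal_def]
  rcases le_total (α.real C) (β.real C) with h | h
  · rw [min_eq_left (ENNReal.ofReal_le_ofReal h), tsub_self, zero_add,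
      ← ENNReal.ofReal_sub _ measureReal_nonneg, abs_sub_comm, abs_of_nonneg (sub_nonneg.2 h)]
  · rw [min_eq_right (ENNReal.ofReal_le_ofReal h), tsub_self, add_zero,
      ← ENNReal.ofReal_sub _ measureReal_nonneg, abs_of_nonneg (sub_nonneg.2 h)]

/-- Subadditivity of the power for `p ≤ 1`, convexity for `p ≥ 1`. The constant equals `2 ^ p *
epsConst p`. -/
lemma add_rpow_le_max_mul {p : ℝ} (hp : 0 < p) {a b : ℝ} (ha : 0 ≤ a) (hb : 0 ≤ b) :
    (a + b) ^ p ≤ max 1 ((2 : ℝ) ^ (p - 1)) * (a ^ p + b ^ p) := by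
  have hab : 0 ≤ a ^ p + b ^ p := by positivity
  rcases le_total p 1 with h | h
  · calc (a + b) ^ p ≤ 1 * (a ^ p + b ^ p) := by
          rw [one_mul]; exact Real.rpow_add_le_add_rpow ha hb hp.le h
      _ ≤ _ := by gcongr; exact le_max_left _ _
  · calc (a + b) ^ p ≤ (2 : ℝ) ^ (p - 1) * (a ^ p + b ^ p) := by
          lift a to NNReal using ha
          lift b to NNReal using hb
          exact_mod_cast NNReal.rpow_add_le_mul_rpow_add_rpow a b h
      _ ≤ _ := by gcongr; exact le_max_right _ _

/-- Partial couplings saturating the shells of a countable partition are completed to a coupling. -/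
lemma transportCost_le_tsum {E : Type*} [NormedAddCommGroup E] [MeasurableSpace E] [BorelSpace E]
    {p : ℝ} (hp : 0 < p) (α β : Measure E) [IsProbabilityMeasure α] [IsProbabilityMeasure β]
    {G : ℕ → Set E} (hG : ∀ n, MeasurableSet (G n)) (hGd : Pairwise (Function.onFun Disjoint G))
    (hGu : ⋃ n, G n = Set.univ) {ρ : ℕ → ℝ} (hρ : ∀ n, ∀ x ∈ G n, ‖x‖ ≤ ρ n)
    (ξ : ℕ → Measure (E × E)) (hξ : ∀ n, IsPartialCoupling α β (ξ n))
    (hξG : ∀ n, ∀ᵐ z ∂ξ n, z.1 ∈ G n ∧ z.2 ∈ G n)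
    (hξu : ∀ n, ξ n Set.univ = min (α (G n)) (β (G n))) :
    transportCost p α β ≤ ∑' n, (∫⁻ z, ENNReal.ofReal (‖z.1 - z.2‖ ^ p) ∂ξ n +
      ENNReal.ofReal (max 1 ((2 : ℝ) ^ (p - 1)) * ρ n ^ p * |α.real (G n) - β.real (G n)|)) := by
  set ζ := Measure.sum ξ with hζ
  have h1 : IsPartialCoupling α β ζ := IsPartialCoupling.sum hG hGd hξ hξG
  have hζfin : IsFiniteMeasure (ζ.map Prod.fst) := isFiniteMeasure_of_le α h1.1
  have hGG : ∀ n m, ∀ᵐ z ∂ξ m, z.1 ∈ G n ↔ z.2 ∈ G n := by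
    intro n m
    filter_upwards [hξG m] with z hz
    by_cases h : n = m
    · subst h; exact ⟨fun _ => hz.2, fun _ => hz.1⟩
    · exact ⟨fun h' => (Set.disjoint_left.1 (hGd h) h' hz.1).elim,
        fun h' => (Set.disjoint_left.1 (hGd h) h' hz.2).elim⟩
  have hfst : ∀ n, ζ.map Prod.fst (G n) = min (α (G n)) (β (G n)) := by
    intro n
    rw [Measure.map_apply measurable_fst (hG n), Measure.sum_apply _ (measurable_fst (hG n)),
      tsum_eq_single n]
    · rw [← hξu n]
      refine measure_congr ?_
      filter_upwards [hξG n] with z hz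
      exact propext ⟨fun _ => trivial, fun _ => hz.1⟩
    · intro m hm
      rw [← Measure.map_apply measurable_fst (hG n)]
      exact map_fst_apply_eq_zero (hG n) (hξG m) (hGd hm.symm)
  have hsnd : ∀ n, ζ.map Prod.snd (G n) = min (α (G n)) (β (G n)) := by
    intro n
    rw [← hfst n]
    refine (map_fst_eq_map_snd_of_ae (hG n) ?_).symm
    rw [hζ, Measure.ae_sum_iff]
    exact hGG n
  -- Extending with the whole space as the only cell raises the total mass to one; dominated
  -- marginals of mass one are then equal to `α` and `β`.
  obtain ⟨η, g1, -, g3⟩ := h1.exists_extension {()} (fun _ => Set.univ) (by simp) (by simp)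
    (by simp [map_fst_univ, map_snd_univ])
  simp only [Finset.sum_singleton, measure_univ, min_self] at g3
  rw [map_fst_univ] at g3
  have hunivη : (ζ + η) Set.univ = 1 := by rw [Measure.add_apply, add_comm, g3]
  have hcoup : ζ + η ∈ couplings α β := by
    constructor
    · have : IsProbabilityMeasure ((ζ + η).map Prod.fst) := ⟨by rw [map_fst_univ, hunivη]⟩
      exact Measure.eq_of_le_of_isProbabilityMeasure g1.1
    · have : IsProbabilityMeasure ((ζ + η).map Prod.snd) := ⟨by rw [map_snd_univ, hunivη]⟩
      exact Measure.eq_of_le_of_isProbabilityMeasure g1.2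
  -- `ζ` already saturates each shell, so `η` can draw only on the excess of one measure over the
  -- other.
  have hη1 : ∀ n, η.map Prod.fst (G n) ≤ α (G n) - min (α (G n)) (β (G n)) := by
    intro n
    have h := g1.1 (G n)
    rw [Measure.map_add _ _ measurable_fst, Measure.add_apply, hfst] at h
    exact ENNReal.le_sub_of_add_le_left (ne_top_of_le_ne_top (measure_ne_top α (G n))
      (min_le_left _ _)) h
  have hη2 : ∀ n, η.map Prod.snd (G n) ≤ β (G n) - min (α (G n)) (β (G n)) := by
    intro n
    have h := g1.2 (G n)
    rw [Measure.map_add _ _ measurable_snd, Measure.add_apply, hsnd] at h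
    exact ENNReal.le_sub_of_add_le_left (ne_top_of_le_ne_top (measure_ne_top α (G n))
      (min_le_left _ _)) h
  have hmeas : Measurable fun x : E => ENNReal.ofReal (‖x‖ ^ p) := by fun_prop
  have hshell : ∀ γ : Measure E, ∫⁻ x, ENNReal.ofReal (‖x‖ ^ p) ∂γ ≤
      ∑' n, ENNReal.ofReal (ρ n ^ p) * γ (G n) := by
    intro γ
    rw [← setLIntegral_univ, ← hGu, lintegral_iUnion hG hGd]
    refine ENNReal.tsum_le_tsum fun n => ?_
    rw [← setLIntegral_const]
    refine setLIntegral_mono' (hG n) fun x hx => ENNReal.ofReal_le_ofReal ?_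
    exact Real.rpow_le_rpow (norm_nonneg _) (hρ n x hx) hp.le
  have hcost : ∫⁻ z, ENNReal.ofReal (‖z.1 - z.2‖ ^ p) ∂η ≤ ∑' n,
      ENNReal.ofReal (max 1 ((2 : ℝ) ^ (p - 1)) * ρ n ^ p * |α.real (G n) - β.real (G n)|) := by
    calc ∫⁻ z, ENNReal.ofReal (‖z.1 - z.2‖ ^ p) ∂η
        ≤ ∫⁻ z, ENNReal.ofReal (max 1 ((2 : ℝ) ^ (p - 1))) *
          (ENNReal.ofReal (‖z.1‖ ^ p) + ENNReal.ofReal (‖z.2‖ ^ p)) ∂η := by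
          refine lintegral_mono fun z => ?_
          rw [← ENNReal.ofReal_add (by positivity) (by positivity),
            ← ENNReal.ofReal_mul (by positivity)]
          refine ENNReal.ofReal_le_ofReal ((Real.rpow_le_rpow (norm_nonneg _)
            (norm_sub_le _ _) hp.le).trans
            (add_rpow_le_max_mul hp (norm_nonneg _) (norm_nonneg _)))
      _ = ENNReal.ofReal (max 1 ((2 : ℝ) ^ (p - 1))) *
          (∫⁻ x, ENNReal.ofReal (‖x‖ ^ p) ∂(η.map Prod.fst) +
            ∫⁻ x, ENNReal.ofReal (‖x‖ ^ p) ∂(η.map Prod.snd)) := by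
          rw [lintegral_map hmeas measurable_fst, lintegral_map hmeas measurable_snd,
            lintegral_const_mul', lintegral_add_left]
          · exact hmeas.comp measurable_fst
          · exact ENNReal.ofReal_ne_top
      _ ≤ ENNReal.ofReal (max 1 ((2 : ℝ) ^ (p - 1))) *
          (∑' n, ENNReal.ofReal (ρ n ^ p) * η.map Prod.fst (G n) +
            ∑' n, ENNReal.ofReal (ρ n ^ p) * η.map Prod.snd (G n)) := by
          gcongr <;> exact hshell _
      _ ≤ _ := by
          rw [← ENNReal.tsum_add, ← ENNReal.tsum_mul_left]
          refine ENNReal.tsum_le_tsum fun n => ?_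
          -- The sign of `ρ n` is known only when the shell contains a point.
          by_cases hne : (G n).Nonempty
          · obtain ⟨x, hx⟩ := hne
            have hρ0 : 0 ≤ ρ n := (norm_nonneg x).trans (hρ n x hx)
            rw [ENNReal.ofReal_mul (by positivity), ENNReal.ofReal_mul (by positivity),
              ← sub_min_add_sub_min_eq_ofReal_abs, ← mul_add, mul_assoc]
            gcongr
            · exact hη1 n
            · exact hη2 n
          · simp [Set.not_nonempty_iff_eq_empty.1 hne]
  calc transportCost p α β ≤ ∫⁻ z, ENNReal.ofReal (‖z.1 - z.2‖ ^ p) ∂(ζ + η) :=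
        iInf₂_le _ hcoup
    _ ≤ _ := by
      rw [lintegral_add_measure, hζ, lintegral_sum_measure, ENNReal.tsum_add]
      gcongr

end Gluing

/-! ### Measurability of the transport cost of the empirical measure -/

section Measurability

lemma lintegral_empiricalMeasure {E : Type*} [MeasurableSpace E] (N : ℕ) (x : ℕ → E)
    {f : E → ℝ≥0∞} (hf : Measurable f) :
    ∫⁻ y, f y ∂empiricalMeasure N x = (N : ℝ≥0∞)⁻¹ * ∑ k ∈ Finset.range N, f (x k) := by
  rw [empiricalMeasure, lintegral_smul_measure, lintegral_finsetSum_measure, smul_eq_mul]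
  simp_rw [lintegral_dirac' _ hf]

lemma empiricalMeasure_apply {E : Type*} [MeasurableSpace E] (N : ℕ) (x : ℕ → E)
    {C : Set E} (hC : MeasurableSet C) : empiricalMeasure N x C
      = (N : ℝ≥0∞)⁻¹ * ∑ k ∈ Finset.range N, C.indicator 1 (x k) := by
  rw [← lintegral_indicator_one hC,
    lintegral_empiricalMeasure N x (measurable_one.indicator hC)]

lemma isProbabilityMeasure_empiricalMeasure {E : Type*} [MeasurableSpace E] {N : ℕ} (hN : 1 ≤ N)
    (x : ℕ → E) : IsProbabilityMeasure (empiricalMeasure N x) := by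
  constructor
  rw [empiricalMeasure_apply N x MeasurableSet.univ]
  simp only [Set.indicator_univ, Pi.one_apply, Finset.sum_const, Finset.card_range, nsmul_eq_mul,
    mul_one]
  exact ENNReal.inv_mul_cancel (by positivity) (by simp)

variable {E : Type*} [NormedAddCommGroup E] [MeasurableSpace E] [BorelSpace E]

/-- The families of conditional laws of the couplings of an empirical measure with `μ`. -/
def couplingFamilies (N : ℕ) (μ : Measure E) : Set (ℕ → Measure E) :=
  {ν | (∀ k ∈ Finset.range N, ν k Set.univ = 1) ∧
    ∑ k ∈ Finset.range N, ν k = (N : ℝ≥0∞) • μ}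

lemma measurable_cost [SecondCountableTopology E] (p : ℝ) :
    Measurable fun z : E × E => ENNReal.ofReal (‖z.1 - z.2‖ ^ p) := by fun_prop

/-- A coupling is determined by the laws of the second coordinate given each atom: averaging `δ_{x
k} ⊗ ν k` gives one inequality, disintegration the other. The index set no longer depends on the
points `x k`. Repeated points cause no trouble, since they share the same conditional law. -/
lemma transportCost_empiricalMeasure_eq [SecondCountableTopology E] [CompleteSpace E] (p : ℝ)
    {N : ℕ} (hN : 1 ≤ N) (μ : Measure E) (x : ℕ → E) :
    transportCost p (empiricalMeasure N x) μ = ⨅ ν ∈ couplingFamilies N μ,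
      (N : ℝ≥0∞)⁻¹ * ∑ k ∈ Finset.range N, ∫⁻ y, ENNReal.ofReal (‖x k - y‖ ^ p) ∂ν k := by
  have hN0 : (N : ℝ≥0∞) ≠ 0 := by positivity
  have hNt : (N : ℝ≥0∞) ≠ ∞ := by simp
  have hcost := measurable_cost (E := E) p
  apply le_antisymm
  · refine le_iInf₂ fun ν hν => ?_
    have hfin : ∀ k ∈ Finset.range N, IsProbabilityMeasure (ν k) := fun k hk => ⟨hν.1 k hk⟩
    have hmem : (N : ℝ≥0∞)⁻¹ • ∑ k ∈ Finset.range N, (ν k).map (Prod.mk (x k)) ∈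
        couplings (empiricalMeasure N x) μ := by
      constructor
      · rw [Measure.map_smul, ← Measure.mapₗ_apply_of_measurable measurable_fst, map_sum,
          empiricalMeasure]
        congr 1
        refine Finset.sum_congr rfl fun k hk => ?_
        have := hfin k hk
        rw [Measure.mapₗ_apply_of_measurable measurable_fst,
          Measure.map_map measurable_fst measurable_prodMk_left]
        change (ν k).map (fun _ => x k) = _
        rw [Measure.map_const, measure_univ, one_smul]
      · rw [Measure.map_smul, ← Measure.mapₗ_apply_of_measurable measurable_snd, map_sum]
        have : ∀ k, Measure.mapₗ Prod.snd ((ν k).map (Prod.mk (x k))) = ν k := by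
          intro k
          rw [Measure.mapₗ_apply_of_measurable measurable_snd,
            Measure.map_map measurable_snd measurable_prodMk_left]
          exact Measure.map_id
        simp_rw [this]
        rw [hν.2, smul_smul, ENNReal.inv_mul_cancel hN0 hNt, one_smul]
    refine (iInf₂_le _ hmem).trans ?_
    rw [lintegral_smul_measure, lintegral_finsetSum_measure, smul_eq_mul]
    refine le_of_eq ?_
    congr 1
    refine Finset.sum_congr rfl fun k _ => ?_
    rw [lintegral_map hcost measurable_prodMk_left]
  · refine le_iInf₂ fun ξ hξ => ?_
    have hprob := isProbabilityMeasure_empiricalMeasure hN x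
    have hξfst : ξ.fst = empiricalMeasure N x := hξ.1
    have : IsFiniteMeasure ξ := ⟨by rw [← map_fst_univ, hξ.1]; exact measure_lt_top _ _⟩
    have : Nonempty E := ⟨x 0⟩
    have hdis : ∀ f : E × E → ℝ≥0∞, Measurable f → ∫⁻ z, f z ∂ξ = (N : ℝ≥0∞)⁻¹ *
        ∑ k ∈ Finset.range N, ∫⁻ y, f (x k, y) ∂ξ.condKernel (x k) := by
      intro f hf
      conv_lhs => rw [← ξ.disintegrate ξ.condKernel]
      rw [Measure.lintegral_compProd hf, hξfst]
      exact lintegral_empiricalMeasure N x hf.lintegral_kernel_prod_right'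
    rw [hdis _ hcost]
    refine iInf₂_le (fun k => ξ.condKernel (x k)) ⟨fun k _ => measure_univ, ?_⟩
    ext s hs
    have h := hdis ((Prod.snd ⁻¹' s).indicator 1)
      (measurable_one.indicator (measurable_snd hs))
    rw [lintegral_indicator_one (measurable_snd hs), ← Measure.map_apply measurable_snd hs,
      hξ.2] at h
    rw [Measure.smul_apply, h, smul_eq_mul, ← mul_assoc, ENNReal.mul_inv_cancel hN0 hNt, one_mul,
      Measure.finsetSum_apply]
    refine Finset.sum_congr rfl fun k _ => ?_
    rw [← lintegral_indicator_one hs]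
    rfl

lemma continuous_lintegral_cost {p : ℝ} (hp : 0 < p) (ν : Measure E) [IsFiniteMeasure ν]
    (hν : absMoment p ν < ∞) :
    Continuous fun x : E => ∫⁻ y, ENNReal.ofReal (‖x - y‖ ^ p) ∂ν := by
  rw [continuous_iff_continuousAt]
  intro x
  refine tendsto_lintegral_filter_of_dominated_convergence
    (fun y => ENNReal.ofReal (max 1 ((2 : ℝ) ^ (p - 1)) * ((‖x‖ + 1) ^ p + ‖y‖ ^ p)))
    (Filter.Eventually.of_forall fun z => by fun_prop) ?_ ?_ ?_
  · filter_upwards [Metric.ball_mem_nhds x one_pos] with z hz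
    refine Filter.Eventually.of_forall fun y => ENNReal.ofReal_le_ofReal ?_
    have hz' : ‖z‖ ≤ ‖x‖ + 1 := by
      have := norm_le_norm_add_norm_sub' z x
      rw [Metric.mem_ball, dist_eq_norm] at hz
      linarith
    calc ‖z - y‖ ^ p ≤ ((‖x‖ + 1) + ‖y‖) ^ p := by
          refine Real.rpow_le_rpow (norm_nonneg _) ((norm_sub_le z y).trans ?_) hp.le
          gcongr
      _ ≤ _ := add_rpow_le_max_mul hp (by positivity) (norm_nonneg _)
  · have : ∀ y : E, ENNReal.ofReal (max 1 ((2 : ℝ) ^ (p - 1)) * ((‖x‖ + 1) ^ p + ‖y‖ ^ p)) =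
        ENNReal.ofReal (max 1 ((2 : ℝ) ^ (p - 1))) *
          (ENNReal.ofReal ((‖x‖ + 1) ^ p) + ENNReal.ofReal (‖y‖ ^ p)) := fun y => by
      rw [← ENNReal.ofReal_add (by positivity) (by positivity), ← ENNReal.ofReal_mul (by positivity)]
    simp_rw [this]
    rw [lintegral_const_mul' _ _ ENNReal.ofReal_ne_top, lintegral_add_left measurable_const,
      lintegral_const]
    exact ENNReal.mul_ne_top ENNReal.ofReal_ne_top (ENNReal.add_ne_top.2
      ⟨ENNReal.mul_ne_top ENNReal.ofReal_ne_top (measure_ne_top _ _), hν.ne⟩)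
  · refine Filter.Eventually.of_forall fun y => ?_
    have : Continuous fun z : E => ENNReal.ofReal (‖z - y‖ ^ p) :=
      ENNReal.continuous_ofReal.comp
        ((continuous_id.sub continuous_const).norm.rpow_const fun _ => Or.inr hp.le)
    exact this.tendsto x

omit [BorelSpace E] in
lemma absMoment_lt_top_of_le {p q : ℝ} (hp : 0 ≤ p) (hpq : p ≤ q) (μ : Measure E)
    [IsFiniteMeasure μ] (h : absMoment q μ < ∞) : absMoment p μ < ∞ := by
  calc absMoment p μ ≤ ∫⁻ x, (1 + ENNReal.ofReal (‖x‖ ^ q)) ∂μ := by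
        refine lintegral_mono fun x => ?_
        rw [← ENNReal.ofReal_one, ← ENNReal.ofReal_add zero_le_one (by positivity)]
        refine ENNReal.ofReal_le_ofReal ?_
        rcases le_total ‖x‖ 1 with h1 | h1
        · have := Real.rpow_le_one (norm_nonneg x) h1 hp
          have : 0 ≤ ‖x‖ ^ q := by positivity
          linarith
        · have := Real.rpow_le_rpow_of_exponent_le h1 hpq
          linarith
    _ < ∞ := by
        rw [lintegral_add_left measurable_const, lintegral_one]
        exact ENNReal.add_lt_top.2 ⟨measure_lt_top _ _, h⟩

/-- An arbitrary infimum of continuous functions is upper semicontinuous, so the uncountable family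
of conditional laws does no harm. -/
lemma measurable_transportCost_empiricalMeasure [SecondCountableTopology E] [CompleteSpace E]
    {p : ℝ} (hp : 0 < p) {N : ℕ} (hN : 1 ≤ N) (μ : Measure E) [IsFiniteMeasure μ]
    (hμ : absMoment p μ < ∞) :
    Measurable fun x : ℕ → E => transportCost p (empiricalMeasure N x) μ := by
  simp_rw [transportCost_empiricalMeasure_eq p hN μ]
  refine UpperSemicontinuous.measurable ?_
  refine upperSemicontinuous_biInf fun ν hν => Continuous.upperSemicontinuous ?_
  refine (ENNReal.continuous_const_mul (by simp; omega)).comp ?_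
  refine continuous_finsetSum _ fun k hk => ?_
  have : IsFiniteMeasure (ν k) := ⟨by rw [hν.1 k hk]; exact ENNReal.one_lt_top⟩
  refine (continuous_lintegral_cost hp (ν k) ?_).comp (continuous_apply k)
  -- Each conditional law is dominated by `N • μ` and inherits its finite moment.
  calc absMoment p (ν k) ≤ absMoment p (∑ k ∈ Finset.range N, ν k) := by
        refine lintegral_mono' (Measure.le_iff.2 fun s _ => ?_) le_rfl
        rw [Measure.finsetSum_apply]
        exact Finset.single_le_sum (f := fun k => ν k s) (fun _ _ => zero_le) hk
    _ < ∞ := by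
        rw [hν.2, absMoment, lintegral_smul_measure]
        exact ENNReal.mul_lt_top (by simp) hμ

end Measurability

/-! ### Fluctuations of the empirical measure of a set -/

section Fluctuations

variable {E Ω : Type*} [MeasurableSpace E] [MeasurableSpace Ω]

lemma empiricalMeasure_real {N : ℕ} (x : ℕ → E) {C : Set E} (hC : MeasurableSet C) :
    (empiricalMeasure N x).real C
      = (N : ℝ)⁻¹ * ∑ k ∈ Finset.range N, C.indicator (1 : E → ℝ) (x k) := by
  rw [measureReal_def, empiricalMeasure_apply N x hC, ENNReal.toReal_mul, ENNReal.toReal_inv,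
    ENNReal.toReal_natCast, ENNReal.toReal_sum]
  · congr 1
    refine Finset.sum_congr rfl fun k _ => ?_
    by_cases h : x k ∈ C <;> simp [h]
  · intro k _
    by_cases h : x k ∈ C <;> simp [h]

lemma integral_abs_le_sqrt {P : Measure Ω} [IsProbabilityMeasure P] {W : Ω → ℝ}
    (hW : MemLp W 2 P) : ∫ ω, |W ω| ∂P ≤ √(∫ ω, W ω ^ 2 ∂P) := by
  have h := variance_nonneg (fun ω => |W ω|) P
  have hW' : MemLp (fun ω => |W ω|) 2 P := hW.abs
  rw [variance_eq_sub hW'] at h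
  refine Real.le_sqrt_of_sq_le ?_
  have h2 : P[(fun ω => |W ω|) ^ 2] = ∫ ω, W ω ^ 2 ∂P := by
    refine integral_congr_ae (Filter.Eventually.of_forall fun ω => ?_)
    simp [sq_abs]
  rw [h2] at h
  linarith

variable {μ : Measure E} {P : Measure Ω} [IsProbabilityMeasure P]
  {X : ℕ → Ω → E}

/-- The number of sample points in `C` is a sum of `N` independent indicators, with variance at most
`N * μ.real C`. -/
lemma lintegral_abs_empiricalMeasure_sub_le (hXm : ∀ k, Measurable (X k)) (hXindep : iIndepFun X P)
    (hXlaw : ∀ k, P.map (X k) = μ) {N : ℕ} (hN : 1 ≤ N) {C : Set E} (hC : MeasurableSet C) :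
    ∫⁻ ω, ENNReal.ofReal |(empiricalMeasure N fun k => X k ω).real C - μ.real C| ∂P
      ≤ ENNReal.ofReal (√(μ.real C / N)) := by
  have hN0 : (0 : ℝ) < N := by exact_mod_cast hN
  set g : E → ℝ := C.indicator 1 with hg
  have hgm : Measurable g := measurable_one.indicator hC
  have hg01 : ∀ x, ‖g x‖ ≤ 1 := fun x => by by_cases h : x ∈ C <;> simp [hg, h]
  have hgX : ∀ k, Measurable (g ∘ X k) := fun k => hgm.comp (hXm k)
  have hL2 : ∀ k, MemLp (g ∘ X k) 2 P := fun k =>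
    MemLp.of_bound (hgX k).aestronglyMeasurable 1 (Filter.Eventually.of_forall fun ω => hg01 _)
  have hmean : ∀ k, ∫ ω, (g ∘ X k) ω ∂P = μ.real C := by
    intro k
    change ∫ ω, g (X k ω) ∂P = _
    rw [← integral_map (hXm k).aemeasurable hgm.aestronglyMeasurable, hXlaw k,
      integral_indicator_one hC]
  have hvar : ∀ k, Var[g ∘ X k; P] ≤ μ.real C := by
    intro k
    refine (variance_le_expectation_sq (hgX k).aestronglyMeasurable).trans (le_of_eq ?_)
    rw [← hmean k]
    refine integral_congr_ae (Filter.Eventually.of_forall fun ω => ?_)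
    by_cases h : X k ω ∈ C <;> simp [hg, h]
  set Z : Ω → ℝ := ∑ k ∈ Finset.range N, g ∘ X k with hZ
  have hZL2 : MemLp Z 2 P := memLp_finsetSum' _ fun k _ => hL2 k
  have hZmean : ∫ ω, Z ω ∂P = N * μ.real C := by
    simp only [hZ, Finset.sum_apply]
    rw [integral_finsetSum _ fun k _ => (hL2 k).integrable (by norm_num)]
    rw [Finset.sum_congr rfl fun k _ => hmean k]
    simp
  have hZvar : Var[Z; P] ≤ N * μ.real C := by
    rw [hZ, IndepFun.variance_sum (fun k _ => hL2 k)]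
    · calc ∑ k ∈ Finset.range N, Var[g ∘ X k; P] ≤ ∑ k ∈ Finset.range N, μ.real C :=
            Finset.sum_le_sum fun k _ => hvar k
        _ = _ := by simp
    · exact fun i _ j _ hij => (hXindep.indepFun hij).comp hgm hgm
  have hWL2 : MemLp (fun ω => Z ω - N * μ.real C) 2 P := hZL2.sub (memLp_const _)
  have hW : ∫ ω, |Z ω - N * μ.real C| ∂P ≤ √(N * μ.real C) := by
    refine (integral_abs_le_sqrt hWL2).trans (Real.sqrt_le_sqrt ?_)
    rw [variance_eq_integral hZL2.aemeasurable, hZmean] at hZvar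
    exact hZvar
  have hpt : ∀ ω, |(empiricalMeasure N fun k => X k ω).real C - μ.real C|
      = (N : ℝ)⁻¹ * |Z ω - N * μ.real C| := by
    intro ω
    rw [empiricalMeasure_real _ hC, ← abs_of_pos (inv_pos.2 hN0), ← abs_mul, abs_of_pos
      (inv_pos.2 hN0), mul_sub, ← mul_assoc, inv_mul_cancel₀ hN0.ne', one_mul]
    simp [hZ, hg]
  simp_rw [hpt]
  rw [← ofReal_integral_eq_lintegral_ofReal]
  · refine ENNReal.ofReal_le_ofReal ?_
    rw [integral_const_mul]
    calc (N : ℝ)⁻¹ * ∫ ω, |Z ω - N * μ.real C| ∂P ≤ (N : ℝ)⁻¹ * √(N * μ.real C) := by gcongr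
      _ = √(μ.real C / N) := by
        rw [← Real.sqrt_sq (inv_pos.2 hN0).le, ← Real.sqrt_mul (by positivity)]
        congr 1
        field_simp
  · exact ((hWL2.integrable (by norm_num)).abs).const_mul _
  · exact Filter.Eventually.of_forall fun ω => by positivity

lemma measurable_empiricalMeasure_real (hXm : ∀ k, Measurable (X k)) (N : ℕ) {C : Set E}
    (hC : MeasurableSet C) : Measurable fun ω => (empiricalMeasure N fun k => X k ω).real C := by
  simp_rw [empiricalMeasure_real _ hC]
  exact (Finset.measurable_sum _ fun k _ =>
    (measurable_one.indicator hC).comp (hXm k)).const_mul _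

/-- This bound beats the square-root one for masses below `1 / (4N)`; combining the two matters for
`p < d/2`. -/
lemma lintegral_abs_empiricalMeasure_sub_le_two_mul (hXm : ∀ k, Measurable (X k))
    [IsFiniteMeasure μ] (hXlaw : ∀ k, P.map (X k) = μ) {N : ℕ} (hN : 1 ≤ N) {C : Set E} (hC : MeasurableSet C) :
    ∫⁻ ω, ENNReal.ofReal |(empiricalMeasure N fun k => X k ω).real C - μ.real C| ∂P
      ≤ ENNReal.ofReal (2 * μ.real C) := by
  have hN0 : (N : ℝ≥0∞) ≠ 0 := by positivity
  have hmeas : ∀ k, Measurable fun ω => C.indicator (1 : E → ℝ≥0∞) (X k ω) := fun k =>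
    (measurable_one.indicator hC).comp (hXm k)
  have hmean : ∫⁻ ω, empiricalMeasure N (fun k => X k ω) C ∂P = μ C := by
    simp_rw [empiricalMeasure_apply N _ hC]
    rw [lintegral_const_mul _ (Finset.measurable_sum _ fun k _ => hmeas k),
      lintegral_finsetSum _ fun k _ => hmeas k]
    have : ∀ k, ∫⁻ ω, C.indicator (1 : E → ℝ≥0∞) (X k ω) ∂P = μ C := by
      intro k
      rw [← lintegral_map (measurable_one.indicator hC) (hXm k), hXlaw k,
        lintegral_indicator_one hC]
    simp_rw [this]
    rw [Finset.sum_const, Finset.card_range, nsmul_eq_mul, ← mul_assoc,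
      ENNReal.inv_mul_cancel hN0 (by simp), one_mul]
  calc ∫⁻ ω, ENNReal.ofReal |(empiricalMeasure N fun k => X k ω).real C - μ.real C| ∂P
      ≤ ∫⁻ ω, (empiricalMeasure N (fun k => X k ω) C + μ C) ∂P := by
        refine lintegral_mono fun ω => ?_
        have := isProbabilityMeasure_empiricalMeasure hN fun k => X k ω
        rw [← ofReal_measureReal, ← ofReal_measureReal,
          ← ENNReal.ofReal_add measureReal_nonneg measureReal_nonneg]
        refine ENNReal.ofReal_le_ofReal ((abs_sub _ _).trans (le_of_eq ?_))
        rw [abs_of_nonneg measureReal_nonneg, abs_of_nonneg measureReal_nonneg]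
    _ = ENNReal.ofReal (2 * μ.real C) := by
        rw [lintegral_add_right _ measurable_const, hmean, lintegral_const, measure_univ, mul_one,
          ← two_mul, ENNReal.ofReal_mul zero_le_two, ofReal_measureReal]
        norm_num

/-- The expected total fluctuation over a finite family of disjoint cells. -/
lemma lintegral_sum_abs_empiricalMeasure_sub_le (hXm : ∀ k, Measurable (X k))
    (hXindep : iIndepFun X P) [IsFiniteMeasure μ]
    (hXlaw : ∀ k, P.map (X k) = μ) {N : ℕ} (hN : 1 ≤ N) {ι : Type*}
    (S : Finset ι) (c : ι → Set E) (hm : ∀ i ∈ S, MeasurableSet (c i))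
    (hd : (S : Set ι).PairwiseDisjoint c) :
    ∫⁻ ω, ENNReal.ofReal
        (∑ i ∈ S, |(empiricalMeasure N fun k => X k ω).real (c i) - μ.real (c i)|) ∂P
      ≤ ENNReal.ofReal (√(S.card * μ.real (⋃ i ∈ S, c i) / N)) := by
  have hsum : ∑ i ∈ S, μ.real (c i) = μ.real (⋃ i ∈ S, c i) :=
    (measureReal_biUnion_finset hd hm).symm
  simp_rw [ENNReal.ofReal_sum_of_nonneg fun i (_ : i ∈ S) => abs_nonneg _]
  rw [lintegral_finsetSum' _ fun i hi => (((measurable_empiricalMeasure_real hXm N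
    (hm i hi)).sub_const _).abs.ennreal_ofReal).aemeasurable]
  calc ∑ i ∈ S, ∫⁻ ω, ENNReal.ofReal
          |(empiricalMeasure N fun k => X k ω).real (c i) - μ.real (c i)| ∂P
      ≤ ∑ i ∈ S, ENNReal.ofReal (√(μ.real (c i) / N)) := Finset.sum_le_sum fun i hi =>
        lintegral_abs_empiricalMeasure_sub_le hXm hXindep hXlaw hN (hm i hi)
    _ = ENNReal.ofReal (∑ i ∈ S, √(μ.real (c i) / N)) :=
        (ENNReal.ofReal_sum_of_nonneg fun i _ => Real.sqrt_nonneg _).symm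
    _ ≤ _ := by
        refine ENNReal.ofReal_le_ofReal (Real.le_sqrt_of_sq_le ?_)
        refine sq_sum_le_card_mul_sum_sq.trans (le_of_eq ?_)
        rw [mul_div_assoc, ← hsum, Finset.sum_div]
        congr 1
        exact Finset.sum_congr rfl fun i _ => Real.sq_sqrt (by positivity)

end Fluctuations

/-! ### The transport cost inside a shell -/

section Shells

/-- Finite measurable partitions `(c i)_{i ∈ S ℓ}`, `ℓ = 0, …, k`, of a set `G`, each refining the
previous one, the first one being trivial. -/
structure IsNestedPartition {E ι : Type*} [MeasurableSpace E] (G : Set E) (k : ℕ)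
    (S : ℕ → Finset ι) (c : ι → Set E) : Prop where
  meas : ∀ ℓ ≤ k, ∀ i ∈ S ℓ, MeasurableSet (c i)
  disj : ∀ ℓ ≤ k, (S ℓ : Set ι).PairwiseDisjoint c
  subset : ∀ ℓ < k, ∀ i ∈ S (ℓ + 1), ∃ j ∈ S ℓ, c i ⊆ c j
  cover : ∀ ℓ ≤ k, ⋃ i ∈ S ℓ, c i = G
  root : ∃ i, S 0 = {i}

/-- Abel summation: it trades the mass matched at each level for the deficits `m 0 - m (ℓ + 1)`,
which total variations over cells control. -/
lemma sum_pow_mul_sub_add (t : ℝ) (m : ℕ → ℝ) (k : ℕ) :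
    ∑ ℓ ∈ Finset.range k, t ^ ℓ * (m ℓ - m (ℓ + 1)) + t ^ k * m k =
      t ^ k * m 0 + (1 - t) * ∑ ℓ ∈ Finset.range k, t ^ ℓ * (m 0 - m (ℓ + 1)) := by
  induction k with
  | zero => simp
  | succ k ih =>
    rw [Finset.sum_range_succ, Finset.sum_range_succ, pow_succ]
    linear_combination ih

variable {E ι : Type*} [MeasurableSpace E] {G : Set E} {k : ℕ} {S : ℕ → Finset ι} {c : ι → Set E}

lemma IsNestedPartition.sum_measureReal (h : IsNestedPartition G k S c) (α : Measure E)
    [IsFiniteMeasure α] {ℓ : ℕ} (hℓ : ℓ ≤ k) : ∑ i ∈ S ℓ, α.real (c i) = α.real G := by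
  rw [← h.cover ℓ hℓ, measureReal_biUnion_finset (h.disj ℓ hℓ) (h.meas ℓ hℓ)]

lemma IsNestedPartition.exists_root (h : IsNestedPartition G k S c) :
    ∃ i, S 0 = {i} ∧ c i = G := by
  obtain ⟨i, hi⟩ := h.root
  refine ⟨i, hi, ?_⟩
  rw [← h.cover 0 (Nat.zero_le _), hi]
  simp

/-- The second bound uses `min a b = (a + b - |a - b|) / 2`: the sums of the masses cancel because
each level partitions `G`. -/
lemma IsNestedPartition.min_sub_sum_min_le (h : IsNestedPartition G k S c) (α β : Measure E)
    [IsFiniteMeasure α] [IsFiniteMeasure β] {ℓ : ℕ} (hℓ : ℓ ≤ k) :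
    min (α.real G) (β.real G) - ∑ i ∈ S ℓ, min (α.real (c i)) (β.real (c i)) ≤
      min (β.real G) ((∑ i ∈ S ℓ, |α.real (c i) - β.real (c i)|) / 2) := by
  refine le_min ?_ ?_
  · have : 0 ≤ ∑ i ∈ S ℓ, min (α.real (c i)) (β.real (c i)) :=
      Finset.sum_nonneg fun i _ => le_min measureReal_nonneg measureReal_nonneg
    linarith [min_le_right (α.real G) (β.real G)]
  · have h1 : ∀ a b : ℝ, min a b = (a + b - |a - b|) / 2 := fun a b => by
      rcases le_total a b with hab | hab
      · rw [min_eq_left hab, abs_of_nonpos (by linarith)]; ring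
      · rw [min_eq_right hab, abs_of_nonneg (by linarith)]; ring
    simp_rw [h1]
    rw [← Finset.sum_div, Finset.sum_sub_distrib, Finset.sum_add_distrib, h.sum_measureReal α hℓ,
      h.sum_measureReal β hℓ]
    linarith [abs_nonneg (α.real G - β.real G)]

/-- A saturating partial coupling inside `G` built from nested partitions of `G`. -/
lemma IsNestedPartition.exists_partialCoupling (h : IsNestedPartition G k S c) (α β : Measure E)
    [IsFiniteMeasure α] [IsFiniteMeasure β] (f : E × E → ℝ≥0∞) {W t : ℝ} (hW : 0 ≤ W)
    (ht0 : 0 ≤ t) (ht1 : t ≤ 1) (hf : ∀ ℓ ≤ k, ∀ i ∈ S ℓ, ∀ x ∈ c i, ∀ y ∈ c i,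
      f (x, y) ≤ ENNReal.ofReal (W * t ^ ℓ)) :
    ∃ ξ : Measure (E × E), IsPartialCoupling α β ξ ∧ (∀ᵐ z ∂ξ, z.1 ∈ G ∧ z.2 ∈ G) ∧
      ξ Set.univ = min (α G) (β G) ∧
      ∫⁻ z, f z ∂ξ ≤ ENNReal.ofReal (W * (t ^ k * β.real G + (1 - t) * ∑ ℓ ∈ Finset.range k,
        t ^ ℓ * min (β.real G) ((∑ i ∈ S (ℓ + 1), |α.real (c i) - β.real (c i)|) / 2))) := by
  obtain ⟨i₀, hi₀, hc₀⟩ := h.exists_root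
  obtain ⟨ξ, h1, h2, h3, v, h4, h5, h6⟩ := exists_partialCoupling_of_nested α β c f k S
    (fun ℓ => ENNReal.ofReal (W * t ^ ℓ)) h.meas h.disj h.subset hf
  rw [hi₀] at h2 h3
  simp only [Finset.mem_singleton, exists_eq_left, hc₀, Finset.sum_singleton] at h2 h3
  refine ⟨ξ, h1, h2, h3, h6.trans ?_⟩
  set m : ℕ → ℝ := fun ℓ => ∑ i ∈ S ℓ, min (α.real (c i)) (β.real (c i)) with hm
  have hmin : ∀ i, min (α (c i)) (β (c i)) = ENNReal.ofReal (min (α.real (c i)) (β.real (c i))) :=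
    fun i => by rw [ENNReal.ofReal_min, ofReal_measureReal, ofReal_measureReal]
  have hmE : ∀ ℓ, ∑ i ∈ S ℓ, min (α (c i)) (β (c i)) = ENNReal.ofReal (m ℓ) := fun ℓ => by
    rw [hm, ENNReal.ofReal_sum_of_nonneg fun i _ => le_min measureReal_nonneg measureReal_nonneg]
    exact Finset.sum_congr rfl fun i _ => hmin i
  have hm0 : ∀ ℓ, 0 ≤ m ℓ := fun ℓ =>
    Finset.sum_nonneg fun i _ => le_min measureReal_nonneg measureReal_nonneg
  have hv : ∀ ℓ < k, v ℓ = ENNReal.ofReal (m ℓ - m (ℓ + 1)) := by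
    intro ℓ hℓ
    have := h4 ℓ hℓ
    rw [hmE, hmE] at this
    rw [ENNReal.ofReal_sub _ (hm0 _), ← this, ENNReal.add_sub_cancel_right ENNReal.ofReal_ne_top]
  have hmono : ∀ ℓ < k, m (ℓ + 1) ≤ m ℓ := by
    intro ℓ hℓ
    have := h4 ℓ hℓ
    rw [hmE, hmE] at this
    refine (ENNReal.ofReal_le_ofReal_iff (hm0 _)).1 ?_
    rw [← this]
    exact le_add_self
  rw [hmE] at h5
  rw [Finset.sum_range_succ, h5, Finset.sum_congr rfl fun ℓ hℓ => by
      rw [hv ℓ (Finset.mem_range.1 hℓ), ← ENNReal.ofReal_mul (by positivity)],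
    ← ENNReal.ofReal_mul (by positivity), ← ENNReal.ofReal_sum_of_nonneg, ← ENNReal.ofReal_add]
  · refine ENNReal.ofReal_le_ofReal ?_
    have habel := sum_pow_mul_sub_add t m k
    calc ∑ ℓ ∈ Finset.range k, W * t ^ ℓ * (m ℓ - m (ℓ + 1)) + W * t ^ k * m k
        = W * (∑ ℓ ∈ Finset.range k, t ^ ℓ * (m ℓ - m (ℓ + 1)) + t ^ k * m k) := by
          rw [mul_add, Finset.mul_sum (s := Finset.range k), mul_assoc]
          congr 1
          exact Finset.sum_congr rfl fun ℓ _ => mul_assoc _ _ _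
      _ = W * (t ^ k * m 0 + (1 - t) * ∑ ℓ ∈ Finset.range k, t ^ ℓ * (m 0 - m (ℓ + 1))) := by
          rw [habel]
      _ ≤ _ := by
          have hm00 : m 0 = min (α.real G) (β.real G) := by simp [hm, hi₀, hc₀]
          have ht1' : 0 ≤ 1 - t := sub_nonneg.2 ht1
          gcongr with ℓ hℓ
          · rw [hm00]; exact min_le_right _ _
          · rw [hm00]
            exact h.min_sub_sum_min_le α β (Finset.mem_range.1 hℓ)
  · exact Finset.sum_nonneg fun ℓ hℓ => mul_nonneg (by positivity)
      (sub_nonneg.2 (hmono ℓ (Finset.mem_range.1 hℓ)))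
  · exact mul_nonneg (by positivity) (hm0 k)
  · exact fun ℓ hℓ => mul_nonneg (by positivity)
      (sub_nonneg.2 (hmono ℓ (Finset.mem_range.1 hℓ)))

/-- Bound for the expected cost inside `G` of the coupling of `exists_partialCoupling`. -/
lemma IsNestedPartition.lintegral_cost_le (h : IsNestedPartition G k S c) {Ω : Type*}
    [MeasurableSpace Ω] {μ : Measure E} [IsProbabilityMeasure μ] {P : Measure Ω}
    [IsProbabilityMeasure P] {X : ℕ → Ω → E} (hXm : ∀ k, Measurable (X k))
    (hXindep : iIndepFun X P) (hXlaw : ∀ k, P.map (X k) = μ) {N : ℕ} (hN : 1 ≤ N)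
    {W t : ℝ} (hW : 0 ≤ W) (ht0 : 0 ≤ t) (ht1 : t ≤ 1) {b : ℕ → ℝ}
    (hb : ∀ ℓ < k, ((S (ℓ + 1)).card : ℝ) ≤ b ℓ) :
    ∫⁻ ω, ENNReal.ofReal (W * (t ^ k * μ.real G + (1 - t) * ∑ ℓ ∈ Finset.range k,
        t ^ ℓ * min (μ.real G) ((∑ i ∈ S (ℓ + 1),
          |(empiricalMeasure N fun k => X k ω).real (c i) - μ.real (c i)|) / 2))) ∂P ≤
      ENNReal.ofReal (W * (t ^ k * μ.real G + (1 - t) * ∑ ℓ ∈ Finset.range k,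
        t ^ ℓ * min (μ.real G) (√(b ℓ * μ.real G / N) / 2))) := by
  have ht1' : 0 ≤ 1 - t := sub_nonneg.2 ht1
  set Y : ℕ → Ω → ℝ := fun ℓ ω => ∑ i ∈ S (ℓ + 1),
    |(empiricalMeasure N fun k => X k ω).real (c i) - μ.real (c i)| with hY
  have hY0 : ∀ ℓ ω, 0 ≤ Y ℓ ω := fun ℓ ω => Finset.sum_nonneg fun i _ => abs_nonneg _
  have hu : 0 ≤ μ.real G := measureReal_nonneg
  have hYm : ∀ ℓ < k, Measurable (Y ℓ) := fun ℓ hℓ => Finset.measurable_sum _ fun i hi =>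
    ((measurable_empiricalMeasure_real hXm N (h.meas _ hℓ i hi)).sub_const _).abs
  have hsplit : ∀ y : ℕ → ℝ, (∀ ℓ, 0 ≤ y ℓ) →
      ENNReal.ofReal (W * (t ^ k * μ.real G + (1 - t) * ∑ ℓ ∈ Finset.range k,
        t ^ ℓ * min (μ.real G) (y ℓ))) = ENNReal.ofReal W * (ENNReal.ofReal (t ^ k * μ.real G) +
        ENNReal.ofReal (1 - t) * ∑ ℓ ∈ Finset.range k, ENNReal.ofReal (t ^ ℓ) *
          ENNReal.ofReal (min (μ.real G) (y ℓ))) := by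
    intro y hy
    have hpos : ∀ ℓ, 0 ≤ t ^ ℓ * min (μ.real G) (y ℓ) := fun ℓ =>
      mul_nonneg (by positivity) (le_min hu (hy ℓ))
    have hs : 0 ≤ ∑ ℓ ∈ Finset.range k, t ^ ℓ * min (μ.real G) (y ℓ) :=
      Finset.sum_nonneg fun ℓ _ => hpos ℓ
    rw [ENNReal.ofReal_mul hW, ENNReal.ofReal_add (by positivity) (by positivity),
      ENNReal.ofReal_mul ht1', ENNReal.ofReal_sum_of_nonneg fun ℓ _ => hpos ℓ]
    congr 3
    exact Finset.sum_congr rfl fun ℓ _ => ENNReal.ofReal_mul (by positivity)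
  rw [lintegral_congr fun ω => hsplit (fun ℓ => Y ℓ ω / 2) fun ℓ =>
    div_nonneg (hY0 ℓ ω) zero_le_two, hsplit _ fun ℓ => by positivity, lintegral_const_mul' _ _ ENNReal.ofReal_ne_top,
    lintegral_add_left measurable_const, lintegral_const, measure_univ, mul_one,
    lintegral_const_mul' _ _ ENNReal.ofReal_ne_top, lintegral_finsetSum']
  · gcongr with ℓ hℓ
    rw [lintegral_const_mul' _ _ ENNReal.ofReal_ne_top]
    gcongr
    have hℓ' : ℓ < k := Finset.mem_range.1 hℓ
    rw [ENNReal.ofReal_min]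
    -- The expectation of a minimum is at most the minimum of the expectations.
    refine le_min ?_ ?_
    · calc _ ≤ ∫⁻ _, ENNReal.ofReal (μ.real G) ∂P :=
            lintegral_mono fun ω => ENNReal.ofReal_le_ofReal (min_le_left _ _)
        _ = _ := by rw [lintegral_const, measure_univ, mul_one]
    · calc _ ≤ ∫⁻ ω, ENNReal.ofReal (1 / 2) * ENNReal.ofReal (Y ℓ ω) ∂P := by
            refine lintegral_mono fun ω => ?_
            rw [← ENNReal.ofReal_mul (by norm_num)]
            refine ENNReal.ofReal_le_ofReal ((min_le_right _ _).trans (le_of_eq ?_))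
            ring
        _ ≤ ENNReal.ofReal (1 / 2) * ENNReal.ofReal (√(b ℓ * μ.real G / N)) := by
            rw [lintegral_const_mul' _ _ ENNReal.ofReal_ne_top]
            gcongr
            refine (lintegral_sum_abs_empiricalMeasure_sub_le hXm hXindep hXlaw hN _ c
              (h.meas _ hℓ') (h.disj _ hℓ')).trans (ENNReal.ofReal_le_ofReal ?_)
            rw [h.cover _ hℓ']
            gcongr
            exact hb ℓ hℓ'
        _ = _ := by
            rw [← ENNReal.ofReal_mul (by norm_num)]
            congr 1
            ring
  · intro ℓ hℓ
    exact (((measurable_const.min ((hYm ℓ (Finset.mem_range.1 hℓ)).div_const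
      2)).ennreal_ofReal).const_mul _).aemeasurable

/-- The nested partitions of the unit ball induce nested partitions of subsets of larger balls. -/
lemma HasNestedPartitions.exists_isNestedPartition {E : Type*} [NormedAddCommGroup E]
    [NormedSpace ℝ E] [MeasurableSpace E] [BorelSpace E] {d : ℕ} {A D r : ℝ}
    (hQ : HasNestedPartitions E d A D r) {ρ : ℝ} (hρ : 0 < ρ) {G : Set E} (hG : MeasurableSet G)
    (hGρ : G ⊆ Metric.ball 0 ρ) (k : ℕ) :
    ∃ (S : ℕ → Finset (Set E)) (c : Set E → Set E), IsNestedPartition G k S c ∧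
      (∀ ℓ < k, ((S (ℓ + 1)).card : ℝ) ≤ A * r ^ (d * (ℓ + 1))) ∧
      ∀ ℓ ≤ k, ∀ C ∈ S ℓ, ∀ x ∈ c C, ∀ y ∈ c C, ‖x - y‖ ≤ ρ * (D * (r ^ ℓ)⁻¹) := by
  -- Depth zero is allowed here, whereas the partitions are given only for depth at least one.
  obtain ⟨Q, h0, h1, h2, h3, h4⟩ := hQ (max k 1) (le_max_right _ _)
  have hk : ∀ {ℓ}, ℓ ≤ k → ℓ ≤ max k 1 := fun h => h.trans (le_max_left _ _)
  have hm : Measurable fun x : E => ρ⁻¹ • x := measurable_const_smul _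
  -- Pieces stay indexed by the original cells, so the cardinality bounds survive even if some
  -- pieces become empty.
  refine ⟨fun ℓ => (Q ℓ).parts, fun C => G ∩ (fun x => ρ⁻¹ • x) ⁻¹' C,
    ⟨fun ℓ hℓ C hC => hG.inter (hm (h2 ℓ (hk hℓ) C hC)), fun ℓ _ C hC C' hC' hne => ?_, ?_, ?_,
      ⟨_, h0⟩⟩, fun ℓ hℓ => h3 (ℓ + 1) (Nat.succ_pos _) (hk hℓ), ?_⟩
  · exact (((Q ℓ).disjoint hC hC' hne).preimage _).mono Set.inter_subset_right
      Set.inter_subset_right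
  · intro ℓ hℓ C hC
    obtain ⟨C', hC', hCC'⟩ := h1 ℓ (lt_of_lt_of_le hℓ (le_max_left _ _)) hC
    exact ⟨C', hC', Set.inter_subset_inter_right _ (Set.preimage_mono hCC')⟩
  · intro ℓ _
    refine Set.Subset.antisymm (Set.iUnion₂_subset fun C _ => Set.inter_subset_left) ?_
    intro x hx
    have hxb : ρ⁻¹ • x ∈ Metric.ball (0 : E) 1 := by
      have := hGρ hx
      rw [mem_ball_zero_iff] at this ⊢
      rw [norm_smul, norm_inv, Real.norm_of_nonneg hρ.le, inv_mul_lt_iff₀ hρ, mul_one]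
      exact this
    rw [← (Q ℓ).sup_parts, Finset.sup_id_set_eq_sUnion] at hxb
    obtain ⟨C, hC, hxC⟩ := hxb
    exact Set.mem_iUnion₂.2 ⟨C, hC, hx, hxC⟩
  · intro ℓ hℓ C hC x hx y hy
    have := h4 ℓ (hk hℓ) C hC _ hx.2 _ hy.2
    rw [← smul_sub, norm_smul, norm_inv, Real.norm_of_nonneg hρ.le, inv_mul_le_iff₀ hρ] at this
    exact this

end Shells

/-! ### Choice of the depth of the partition -/

section Depth

/-- Here and in the next two lemmas `b = r ^ p`, `a = r ^ (d/2)` and `x = √(A/(Nu)) / 2`. For `a <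
b` the series converges, and its sum leaves room for `b⁻¹` times the right-hand side, which absorbs
`b⁻¹ ^ k` for large `k`. -/
lemma exists_depth_of_lt {a b x : ℝ} (ha : 0 < a) (hb : 1 < b) (hab : a < b) (hx : 0 < x) :
    ∃ k : ℕ, b⁻¹ ^ k + (1 - b⁻¹) * (a * x) * ∑ ℓ ∈ Finset.range k, (b⁻¹ * a) ^ ℓ
      ≤ a * x / (1 - b⁻¹ * a) := by
  have hb0 : 0 < b := by linarith
  have hta : b⁻¹ * a < 1 := by rwa [inv_mul_lt_iff₀ hb0, mul_one]
  have h1 : 0 < 1 - b⁻¹ * a := sub_pos.2 hta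
  have hb1 : b⁻¹ < 1 := inv_lt_one_of_one_lt₀ hb
  obtain ⟨k, hk⟩ := exists_pow_lt_of_lt_one (show 0 < b⁻¹ * (a * x / (1 - b⁻¹ * a)) by positivity)
    hb1
  refine ⟨k, ?_⟩
  have hsum : ∑ ℓ ∈ Finset.range k, (b⁻¹ * a) ^ ℓ ≤ 1 / (1 - b⁻¹ * a) := by
    rw [le_div_iff₀ h1, mul_comm, mul_neg_geom_sum]
    have : 0 < (b⁻¹ * a) ^ k := by positivity
    linarith
  have h2 : 0 ≤ (1 - b⁻¹) * (a * x) := mul_nonneg (sub_nonneg.2 hb1.le) (by positivity)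
  calc _ ≤ b⁻¹ * (a * x / (1 - b⁻¹ * a)) + (1 - b⁻¹) * (a * x) * (1 / (1 - b⁻¹ * a)) := by
        gcongr
    _ = _ := by ring

/-- With `a = b` the sum grows linearly in `k`, so the depth is the logarithm of `z` in base `b`,
rounded up, or zero when `z ≤ 1`. -/
lemma exists_depth_of_eq {b x : ℝ} (hb : 1 < b) (hx : 0 < x) :
    ∃ k : ℕ, b⁻¹ ^ k + (1 - b⁻¹) * (b * x) * k
      ≤ x * (b / Real.log b * Real.posLog ((b - 1) / b ^ 2 / x) + b ^ 2 / (b - 1)) := by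
  have hb0 : 0 < b := by linarith
  have hb1 : 0 < b - 1 := by linarith
  have hlog : 0 < Real.log b := Real.log_pos hb
  set z := (b - 1) / b ^ 2 / x with hz
  have hz0 : 0 < z := by positivity
  have hxz : x * z * (b ^ 2 / (b - 1)) = 1 := by rw [hz]; field_simp
  rcases le_total z 1 with h | h
  · refine ⟨0, ?_⟩
    have h1 : Real.posLog z = 0 := by
      exact max_eq_left (Real.log_nonpos hz0.le h)
    rw [h1]
    simp only [pow_zero, Nat.cast_zero, mul_zero, add_zero, zero_add]
    have : 0 < x * (b ^ 2 / (b - 1)) := by positivity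
    nlinarith [hxz]
  · set L := Real.log z / Real.log b with hL
    have hL0 : 0 ≤ L := div_nonneg (Real.log_nonneg h) hlog.le
    have h1 : b / Real.log b * Real.posLog z = b * L := by
      have : Real.posLog z = Real.log z := max_eq_right (Real.log_nonneg h)
      rw [this, hL]
      ring
    rw [h1]
    set k := ⌈L⌉₊ with hk
    set f := (k : ℝ) - L with hf
    have hf0 : 0 ≤ f := sub_nonneg.2 (Nat.le_ceil L)
    have hf1 : f ≤ 1 := by have := Nat.ceil_lt_add_one hL0; rw [hf]; linarith
    have hbL : b ^ L = z := by
      rw [Real.rpow_def_of_pos hb0, hL, mul_div_cancel₀ _ hlog.ne', Real.exp_log hz0]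
    have hbk : b⁻¹ ^ k = z⁻¹ * b⁻¹ ^ f := by
      have : (k : ℝ) = L + f := by rw [hf]; ring
      rw [← Real.rpow_natCast, this, Real.rpow_add (inv_pos.2 hb0), Real.inv_rpow hb0.le, hbL]
    -- Bernoulli's inequality makes the gain from rounding up linear in `f`, enough to pay for the
    -- extra `f` in the linear term.
    have hbern : b⁻¹ ^ f ≤ 1 + f * (b⁻¹ - 1) := by
      have := rpow_one_add_le_one_add_mul_self (s := b⁻¹ - 1)
        (by have := inv_pos.2 hb0; linarith) hf0 hf1
      rwa [add_sub_cancel] at this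
    refine ⟨k, ?_⟩
    have hzinv : z⁻¹ = x * (b ^ 2 / (b - 1)) := by rw [hz]; field_simp
    have hkf : (k : ℝ) = L + f := by rw [hf]; ring
    calc b⁻¹ ^ k + (1 - b⁻¹) * (b * x) * k
        ≤ x * (b ^ 2 / (b - 1)) * (1 + f * (b⁻¹ - 1)) + (1 - b⁻¹) * (b * x) * k := by
          rw [hbk, hzinv]; gcongr
      _ = x * ((b - 1) * L + b ^ 2 / (b - 1) - f) := by rw [hkf]; field_simp; ring
      _ ≤ _ := by gcongr; nlinarith

/-- The depth is where `a ^ k` reaches the order of `1 / x`. With `s = 1 / (a ^ k * x)` in `[1, a]`,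
the cost becomes `x ^ θ * (s ^ θ + C * s ^ (θ - 1)) - C * x`, and the bracket is at most its common
value `1 + C` at the two endpoints. -/
lemma exists_depth_of_gt {a b x θ : ℝ} (hb : 1 < b) (hab : b < a) (hx : 0 < x)
    (hθ0 : 0 < θ) (hθ1 : θ < 1) (haθ : a ^ θ = b) :
    ∃ k : ℕ, b⁻¹ ^ k + (1 - b⁻¹) * (a * x) * ∑ ℓ ∈ Finset.range k, (b⁻¹ * a) ^ ℓ
      ≤ x ^ θ * (b ^ 2 * (a - 1) ^ (1 - θ) / (a - b)) := by
  have hb0 : 0 < b := by linarith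
  have ha0 : 0 < a := by linarith
  have ha1 : 0 < a - 1 := by linarith
  have hb1 : 0 < b - 1 := by linarith
  have hab0 : 0 < a - b := by linarith
  set C := a * (b - 1) / (a - b) with hC
  have hC0 : 0 < C := by positivity
  have hC1 : 1 + C = b * (a - 1) / (a - b) := by rw [hC]; field_simp; ring
  have hCle : 1 + C ≤ b ^ 2 * (a - 1) ^ (1 - θ) / (a - b) := by
    rw [hC1, Real.rpow_sub ha1, Real.rpow_one, div_le_div_iff_of_pos_right hab0]
    have h1 : (a - 1) ^ θ ≤ b := by
      rw [← haθ]; exact Real.rpow_le_rpow ha1.le (by linarith) hθ0.le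
    have h2 : 0 < (a - 1) ^ θ := by positivity
    rw [← mul_div_assoc, le_div_iff₀ h2]
    calc b * (a - 1) * (a - 1) ^ θ ≤ b * (a - 1) * b := by gcongr
      _ = b ^ 2 * (a - 1) := by ring
  suffices h : ∃ k : ℕ, b⁻¹ ^ k + (1 - b⁻¹) * (a * x) * ∑ ℓ ∈ Finset.range k, (b⁻¹ * a) ^ ℓ
      ≤ x ^ θ * (1 + C) by
    obtain ⟨k, hk⟩ := h
    exact ⟨k, hk.trans (by gcongr)⟩
  rcases le_total 1 x with h | h
  · refine ⟨0, ?_⟩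
    have := Real.one_le_rpow h hθ0.le
    simp only [pow_zero, Finset.range_zero, Finset.sum_empty, mul_zero, add_zero]
    nlinarith
  · obtain ⟨k, hk1, hk2⟩ := exists_nat_pow_near (one_le_inv_iff₀.2 ⟨hx, h⟩)
      (show 1 < a by linarith)
    refine ⟨k, ?_⟩
    set s := (a ^ k)⁻¹ / x with hs
    have hak : 0 < a ^ k := by positivity
    have hs0 : 0 < s := by positivity
    have hs1 : 1 ≤ s := by
      rw [hs, le_div_iff₀ hx, one_mul]
      exact (le_inv_comm₀ hak hx).1 hk1
    have hsa : s ≤ a := by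
      rw [hs, div_le_iff₀ hx, inv_le_iff_one_le_mul₀ hak]
      rw [pow_succ, inv_lt_iff_one_lt_mul₀ hx] at hk2
      nlinarith
    have hxs : x * s = (a ^ k)⁻¹ := by rw [hs]; field_simp
    have hbk : b⁻¹ ^ k = x ^ θ * s ^ θ := by
      rw [← Real.mul_rpow hx.le hs0.le, hxs, ← haθ, Real.inv_rpow hak.le, inv_pow,
        ← Real.rpow_natCast, ← Real.rpow_natCast, ← Real.rpow_mul ha0.le, ← Real.rpow_mul ha0.le,
        mul_comm]
    have hgeom : (1 - b⁻¹) * (a * x) * ∑ ℓ ∈ Finset.range k, (b⁻¹ * a) ^ ℓ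
        = C * x * (x ^ θ * s ^ θ * a ^ k - 1) := by
      have hne : b⁻¹ * a ≠ 1 := by
        intro h'
        rw [inv_mul_eq_iff_eq_mul₀ hb0.ne', mul_one] at h'
        linarith
      rw [geom_sum_eq hne, mul_pow, hbk, hC]
      have : b⁻¹ * a - 1 = (a - b) / b := by field_simp
      rw [this]
      field_simp
    -- Concavity of `s ↦ s ^ (1 - θ)` on `[1, a]`; the chord through the endpoints is exactly `(s +
    -- C) / (1 + C)`.
    have hconc : s + C ≤ (1 + C) * s ^ (1 - θ) := by
      have hcc := (Real.concaveOn_rpow (p := 1 - θ) (by linarith) (by linarith)).2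
        (show (1 : ℝ) ∈ Set.Ici 0 by simp) (show a ∈ Set.Ici 0 from ha0.le)
        (show 0 ≤ (a - s) / (a - 1) from div_nonneg (by linarith) ha1.le)
        (show 0 ≤ (s - 1) / (a - 1) from div_nonneg (by linarith) ha1.le)
        (by field_simp; ring)
      simp only [smul_eq_mul, Real.one_rpow, mul_one] at hcc
      have hs' : (a - s) / (a - 1) + (s - 1) / (a - 1) * a = s := by field_simp; ring
      rw [hs', Real.rpow_sub ha0, Real.rpow_one, haθ] at hcc
      calc s + C = (1 + C) * ((a - s) / (a - 1) + (s - 1) / (a - 1) * (a / b)) := by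
            rw [hC1, hC]; field_simp; ring
        _ ≤ _ := by gcongr
    rw [hbk, hgeom]
    have hsθ : s ^ θ * s ^ (1 - θ) = s := by
      rw [← Real.rpow_add hs0, add_sub_cancel, Real.rpow_one]
    have hak' : a ^ k * (x * s) = 1 := by rw [hxs]; field_simp
    have hxθ : 0 < x ^ θ := by positivity
    have hsθ0 : 0 < s ^ θ := by positivity
    have key : s ^ θ + C * (s ^ θ / s) ≤ 1 + C := by
      have : s ^ θ + C * (s ^ θ / s) = (s + C) / s ^ (1 - θ) := by
        have h' : 0 < s ^ (1 - θ) := by positivity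
        rw [eq_div_iff h'.ne']
        calc (s ^ θ + C * (s ^ θ / s)) * s ^ (1 - θ)
            = s ^ θ * s ^ (1 - θ) + C * (s ^ θ * s ^ (1 - θ)) / s := by ring
          _ = s + C := by rw [hsθ, mul_div_assoc, div_self hs0.ne', mul_one]
      rw [this, div_le_iff₀ (by positivity)]
      exact hconc
    have e : x * (x ^ θ * s ^ θ * a ^ k) = x ^ θ * (s ^ θ / s) := by
      have : x * a ^ k = 1 / s := by field_simp; linarith
      calc x * (x ^ θ * s ^ θ * a ^ k) = x ^ θ * s ^ θ * (x * a ^ k) := by ring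
        _ = _ := by rw [this]; ring
    calc x ^ θ * s ^ θ + C * x * (x ^ θ * s ^ θ * a ^ k - 1)
        = x ^ θ * (s ^ θ + C * (s ^ θ / s)) - C * x := by
          rw [mul_sub, mul_assoc C, e]; ring
      _ ≤ x ^ θ * (1 + C) - 0 := by
          gcongr
          positivity
      _ = _ := sub_zero _

end Depth

/-! ### The cost of a shell in the three regimes -/

section Regimes

/-- The cost inside a shell of mass `u`, relative to the scale of the shell, when partitions of
depth `k` are used. -/
noncomputable def depthCost (d : ℕ) (A r p : ℝ) (N : ℕ) (u : ℝ) (k : ℕ) : ℝ :=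
  (r ^ (-p)) ^ k * u + (1 - r ^ (-p)) * ∑ ℓ ∈ Finset.range k,
    (r ^ (-p)) ^ ℓ * min u (√(A * r ^ (d * (ℓ + 1)) * u / N) / 2)

variable {d N : ℕ} {A r p u : ℝ}

lemma depthCost_zero (k : ℕ) : depthCost d A r p N 0 k = 0 := by simp [depthCost]

lemma depthCost_le (hA : 0 < A) (hr : 1 < r) (hp : 0 < p) (hN : 1 ≤ N) (hu : 0 < u) (k : ℕ) :
    depthCost d A r p N u k ≤ u * ((r ^ p)⁻¹ ^ k + (1 - (r ^ p)⁻¹) *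
      (r ^ ((d : ℝ) / 2) * (√(A / (N * u)) / 2)) *
      ∑ ℓ ∈ Finset.range k, ((r ^ p)⁻¹ * r ^ ((d : ℝ) / 2)) ^ ℓ) := by
  have hr0 : 0 < r := by linarith
  have hN0 : (0 : ℝ) < N := by exact_mod_cast hN
  have hb1 : (r ^ p)⁻¹ ≤ 1 := inv_le_one_of_one_le₀ (Real.one_le_rpow hr.le hp.le)
  have ha2 : (r ^ ((d : ℝ) / 2)) ^ 2 = r ^ d := by
    rw [← Real.rpow_natCast, ← Real.rpow_mul hr0.le, ← Real.rpow_natCast]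
    congr 1
    push_cast
    ring
  rw [depthCost, Real.rpow_neg hr0.le]
  set a := r ^ ((d : ℝ) / 2) with ha
  set t := (r ^ p)⁻¹ with ht
  have ha0 : 0 < a := by positivity
  have ht0 : 0 < t := by positivity
  have hsqrt : ∀ ℓ : ℕ, √(A * r ^ (d * (ℓ + 1)) * u / N) = u * a ^ (ℓ + 1) * √(A / (N * u)) := by
    intro ℓ
    rw [pow_mul, ← ha2, ← Real.sqrt_sq (show 0 ≤ u * a ^ (ℓ + 1) by positivity),
      ← Real.sqrt_mul (by positivity)]
    congr 1
    field_simp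
    ring
  have hmin : ∀ ℓ : ℕ, min u (√(A * r ^ (d * (ℓ + 1)) * u / N) / 2) ≤
      u * (a * (√(A / (N * u)) / 2)) * a ^ ℓ := fun ℓ => by
    refine (min_le_right _ _).trans (le_of_eq ?_)
    rw [hsqrt, pow_succ]
    ring
  calc _ ≤ t ^ k * u + (1 - t) * ∑ ℓ ∈ Finset.range k,
        t ^ ℓ * (u * (a * (√(A / (N * u)) / 2)) * a ^ ℓ) := by
        have : 0 ≤ 1 - t := sub_nonneg.2 hb1
        gcongr with ℓ _
        exact hmin ℓ
    _ = _ := by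
        simp only [mul_add, Finset.mul_sum, mul_pow]
        congr 1
        · ring
        · exact Finset.sum_congr rfl fun ℓ _ => by ring

lemma mul_sqrt_div_two (hA : 0 < A) (hN : 1 ≤ N) (hu : 0 < u) :
    u * (√(A / (N * u)) / 2) = √A * √u / (2 * √N) := by
  have hN0 : (0 : ℝ) < N := by exact_mod_cast hN
  rw [Real.sqrt_div hA.le, Real.sqrt_mul hN0.le]
  have h1 : √u * √u = u := Real.mul_self_sqrt hu.le
  have h2 : 0 < √u := Real.sqrt_pos.2 hu
  have h3 : 0 < √(N : ℝ) := Real.sqrt_pos.2 hN0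
  field_simp
  rw [sq, h1]

lemma exists_depthCost_le_high {D : ℝ} (hA : 0 < A) (hD : 0 < D) (hr : 1 < r) (hp : 0 < p)
    (hN : 1 ≤ N) (hdp : (d : ℝ) / 2 < p) (hu : 0 ≤ u) :
    ∃ k, D ^ p * depthCost d A r p N u k ≤
      (2 : ℝ) ^ p * (kappaHigh d A D r p / √(N : ℝ)) * u ^ (1 / 2 : ℝ) := by
  -- A null shell is set aside because `x` has `u` in a denominator.
  rcases hu.eq_or_lt with rfl | hu
  · exact ⟨0, by rw [depthCost_zero]; simp⟩
  have hr0 : 0 < r := by linarith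
  have hN0 : (0 : ℝ) < N := by exact_mod_cast hN
  have hx : 0 < √(A / (N * u)) / 2 := by positivity
  have ha0 : 0 < r ^ ((d : ℝ) / 2) := by positivity
  have hab : r ^ ((d : ℝ) / 2) < r ^ p := Real.rpow_lt_rpow_of_exponent_lt hr hdp
  obtain ⟨k, hk⟩ := exists_depth_of_lt ha0 (Real.one_lt_rpow hr hp) hab hx
  refine ⟨k, (mul_le_mul_of_nonneg_left ((depthCost_le hA hr hp hN hu k).trans
    (mul_le_mul_of_nonneg_left hk hu.le)) (by positivity)).trans (le_of_eq ?_)⟩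
  have hta : (r ^ p)⁻¹ * r ^ ((d : ℝ) / 2) = r ^ ((d : ℝ) / 2 - p) := by
    rw [Real.rpow_sub hr0]; ring
  have hsq : √(A * r ^ d) = √A * r ^ ((d : ℝ) / 2) := by
    rw [Real.sqrt_mul hA.le, Real.sqrt_eq_rpow (r ^ d), ← Real.rpow_natCast, ← Real.rpow_mul hr0.le]
    congr 2
    ring
  have hne : 1 - r ^ ((d : ℝ) / 2 - p) ≠ 0 :=
    (sub_pos.2 (Real.rpow_lt_one_of_one_lt_of_neg hr (by linarith))).ne'
  calc D ^ p * (u * (r ^ ((d : ℝ) / 2) * (√(A / (N * u)) / 2) / (1 - (r ^ p)⁻¹ *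
        r ^ ((d : ℝ) / 2)))) = D ^ p * (u * (√(A / (N * u)) / 2)) * r ^ ((d : ℝ) / 2) /
          (1 - r ^ ((d : ℝ) / 2 - p)) := by rw [hta]; ring
    _ = _ := by
      rw [mul_sqrt_div_two hA hN hu, kappaHigh, hsq, ← Real.sqrt_eq_rpow, Real.rpow_add two_pos,
        Real.rpow_one]
      field_simp

lemma exists_depthCost_le_critical {D : ℝ} (hA : 0 < A) (hD : 0 < D) (hr : 1 < r) (hp : 0 < p)
    (hN : 1 ≤ N) (hdp : p = (d : ℝ) / 2) (hu : 0 ≤ u) (hu1 : u ≤ 1) :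
    ∃ k, D ^ p * depthCost d A r p N u k ≤
      (2 : ℝ) ^ p * (kappaCritical A D r p N / √(N : ℝ)) * u ^ (1 / 2 : ℝ) := by
  rcases hu.eq_or_lt with rfl | hu
  · exact ⟨0, by rw [depthCost_zero]; simp⟩
  have hr0 : 0 < r := by linarith
  have hN0 : (0 : ℝ) < N := by exact_mod_cast hN
  have hx : 0 < √(A / (N * u)) / 2 := by positivity
  have hb1 := Real.one_lt_rpow hr hp
  obtain ⟨k, hk⟩ := exists_depth_of_eq hb1 hx
  have hcost := depthCost_le (d := d) hA hr hp hN hu k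
  rw [← hdp, inv_mul_cancel₀ (by positivity)] at hcost
  simp only [one_pow, Finset.sum_const, Finset.card_range, nsmul_eq_mul, mul_one] at hcost
  refine ⟨k, (mul_le_mul_of_nonneg_left (hcost.trans
    (mul_le_mul_of_nonneg_left hk hu.le)) (by positivity)).trans ?_⟩
  set b := r ^ p with hb
  have hb0 : 0 < b := by positivity
  have hb1' : 0 < b - 1 := by linarith
  have hlogb : Real.log b = p * Real.log r := Real.log_rpow hr0 p
  have hlogr : 0 < Real.log r := Real.log_pos hr
  have h2p : r ^ (2 * p) = b ^ 2 := by
    rw [hb, ← Real.rpow_natCast, ← Real.rpow_mul hr0.le]; congr 1; push_cast; ring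
  -- Since `u ≤ 1`, the logarithm can be made independent of the mass of the shell.
  have harg : (b - 1) / b ^ 2 / (√(A / (N * u)) / 2) ≤
      2 * (r ^ (-p) - r ^ (-(2 * p))) * √((N : ℝ) / A) := by
    rw [Real.rpow_neg hr0.le, Real.rpow_neg hr0.le, h2p, ← hb]
    have e1 : b⁻¹ - (b ^ 2)⁻¹ = (b - 1) / b ^ 2 := by field_simp
    have e2 : (√(A / (N * u)))⁻¹ ≤ √((N : ℝ) / A) := by
      rw [← Real.sqrt_inv, inv_div]
      refine Real.sqrt_le_sqrt ?_
      gcongr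
      exact mul_le_of_le_one_right hN0.le hu1
    calc (b - 1) / b ^ 2 / (√(A / (N * u)) / 2)
        = 2 * ((b - 1) / b ^ 2) * (√(A / (N * u)))⁻¹ := by field_simp
      _ ≤ _ := by rw [e1]; gcongr
  have hpos : (b - 1) / b ^ 2 / (√(A / (N * u)) / 2) ≥ 0 := by positivity
  have hlog := Real.posLog_le_posLog hpos harg
  have hN' : 0 < √(N : ℝ) := Real.sqrt_pos.2 hN0
  calc D ^ p * (u * (√(A / (N * u)) / 2 * (b / Real.log b *
        Real.posLog ((b - 1) / b ^ 2 / (√(A / (N * u)) / 2)) + b ^ 2 / (b - 1))))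
      = D ^ p * (u * (√(A / (N * u)) / 2)) * (b / (p * Real.log r) *
        Real.posLog ((b - 1) / b ^ 2 / (√(A / (N * u)) / 2)) + b ^ 2 / (b - 1)) := by
        rw [hlogb]; ring
    _ ≤ D ^ p * (u * (√(A / (N * u)) / 2)) * (b / (p * Real.log r) *
        Real.posLog (2 * (r ^ (-p) - r ^ (-(2 * p))) * √((N : ℝ) / A)) + b ^ 2 / (b - 1)) := by
        gcongr
    _ = _ := by
      rw [mul_sqrt_div_two hA hN hu, kappaCritical, ← Real.sqrt_eq_rpow, Real.rpow_add two_pos,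
        Real.rpow_one, h2p, ← hb]
      field_simp

lemma exists_depthCost_le_low {D : ℝ} (hA : 0 < A) (hD : 0 < D) (hr : 1 < r) (hp : 0 < p)
    (hN : 1 ≤ N) (hdp : p < (d : ℝ) / 2) (hu : 0 ≤ u) :
    ∃ k, D ^ p * depthCost d A r p N u k ≤
      (2 : ℝ) ^ p * (kappaLow d A D r p / (N : ℝ) ^ (p / d)) * u ^ (1 - p / d) := by
  have hd0 : (0 : ℝ) < d := by linarith
  have hpd : p / d < 1 / 2 := by rw [div_lt_iff₀ hd0]; linarith
  have hpd0 : 0 < p / d := by positivity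
  rcases hu.eq_or_lt with rfl | hu
  · exact ⟨0, by rw [depthCost_zero, Real.zero_rpow (by linarith)]; simp⟩
  have hr0 : 0 < r := by linarith
  have hN0 : (0 : ℝ) < N := by exact_mod_cast hN
  have hx : 0 < √(A / (N * u)) / 2 := by positivity
  have hb1 := Real.one_lt_rpow hr hp
  have hab : r ^ p < r ^ ((d : ℝ) / 2) := Real.rpow_lt_rpow_of_exponent_lt hr hdp
  have hθ : 2 * p / d = 2 * (p / d) := by ring
  have haθ : (r ^ ((d : ℝ) / 2)) ^ (2 * p / d) = r ^ p := by
    rw [← Real.rpow_mul hr0.le]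
    congr 1
    field_simp
  obtain ⟨k, hk⟩ := exists_depth_of_gt hb1 hab hx (θ := 2 * p / d) (by positivity)
    (by rw [hθ]; linarith) haθ
  refine ⟨k, (mul_le_mul_of_nonneg_left ((depthCost_le hA hr hp hN hu k).trans
    (mul_le_mul_of_nonneg_left hk hu.le)) (by positivity)).trans (le_of_eq ?_)⟩
  set a := r ^ ((d : ℝ) / 2) with ha
  set b := r ^ p with hb
  have hb0 : 0 < b := by positivity
  have hx' : (√(A / (N * u)) / 2) ^ (2 * p / d) =
      A ^ (p / d) / ((N : ℝ) ^ (p / d) * u ^ (p / d)) / (2 : ℝ) ^ (2 * p / d) := by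
    rw [Real.div_rpow (Real.sqrt_nonneg _) zero_le_two, Real.sqrt_eq_rpow,
      ← Real.rpow_mul (by positivity), show 1 / 2 * (2 * p / d) = p / d by ring,
      Real.div_rpow hA.le (by positivity), Real.mul_rpow hN0.le hu.le]
  have hab' : r ^ ((d : ℝ) / 2 - p) = a / b := Real.rpow_sub hr0 _ _
  have hne : a - b ≠ 0 := (sub_pos.2 hab).ne'
  have hne' : a / b - 1 = (a - b) / b := by field_simp
  rw [hx', kappaLow, hab', ← ha, ← hb, hne', Real.rpow_add two_pos, Real.rpow_sub hu, Real.rpow_one]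
  field_simp

end Regimes

/-! ### Summation over the shells -/

section Summation

lemma IsNestedPartition.measurable_cost {E ι : Type*} [MeasurableSpace E] {G : Set E} {k : ℕ}
    {S : ℕ → Finset ι} {c : ι → Set E} (h : IsNestedPartition G k S c) {Ω : Type*}
    [MeasurableSpace Ω] {X : ℕ → Ω → E} (hXm : ∀ k, Measurable (X k)) (μ : Measure E) (N : ℕ)
    (W t : ℝ) : Measurable fun ω => ENNReal.ofReal (W * (t ^ k * μ.real G + (1 - t) *
      ∑ ℓ ∈ Finset.range k, t ^ ℓ * min (μ.real G) ((∑ i ∈ S (ℓ + 1),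
          |(empiricalMeasure N fun k => X k ω).real (c i) - μ.real (c i)|) / 2))) := by
  refine (((Finset.measurable_sum _ fun ℓ hℓ => ?_).const_mul _).const_add _
    |>.const_mul _).ennreal_ofReal
  refine (measurable_const.min ((Finset.measurable_sum _ fun i hi => ?_).div_const 2)).const_mul _
  exact ((measurable_empiricalMeasure_real hXm N
    (h.meas _ (Finset.mem_range.1 hℓ) i hi)).sub_const _).abs

lemma two_rpow_mul_epsConst (p : ℝ) : (2 : ℝ) ^ p * epsConst p = max 1 ((2 : ℝ) ^ (p - 1)) := by
  rw [epsConst, mul_max_of_nonneg _ _ (by positivity), ← Real.rpow_add two_pos, add_neg_cancel,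
    Real.rpow_zero, Real.rpow_sub two_pos, Real.rpow_one, max_comm]
  congr 1
  ring

lemma measureReal_compl_ball_le {E : Type*} [NormedAddCommGroup E] [MeasurableSpace E]
    [BorelSpace E] {μ : Measure E} [IsProbabilityMeasure μ] {q : ℝ} (hq : 0 < q)
    (hM : absMoment q μ < ∞) {R : ℝ} (hR : 0 < R) :
    μ.real (Metric.ball 0 R)ᶜ ≤ (absMoment q μ).toReal * R ^ (-q) := by
  have hmeas : Measurable fun x : E => ENNReal.ofReal (‖x‖ ^ q) := by fun_prop
  have h := mul_meas_ge_le_lintegral (μ := μ) hmeas (ENNReal.ofReal (R ^ q))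
  have hsub : (Metric.ball (0 : E) R)ᶜ ⊆ {x | ENNReal.ofReal (R ^ q) ≤ ENNReal.ofReal (‖x‖ ^ q)} := by
    intro x hx
    rw [Set.mem_compl_iff, mem_ball_zero_iff, not_lt] at hx
    exact ENNReal.ofReal_le_ofReal (Real.rpow_le_rpow hR.le hx hq.le)
  have h2 := (mul_le_mul_right (measure_mono hsub) (ENNReal.ofReal (R ^ q))).trans h
  have h3 := ENNReal.toReal_mono hM.ne h2
  rw [ENNReal.toReal_mul, ENNReal.toReal_ofReal (by positivity), ← measureReal_def] at h3
  rw [Real.rpow_neg hR.le, ← div_eq_mul_inv, le_div_iff₀ (by positivity), mul_comm]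
  exact h3

variable {E : Type*} [NormedAddCommGroup E] [NormedSpace ℝ E]
  [MeasurableSpace E] [BorelSpace E] {d : ℕ} {A D r : ℝ} {μ : Measure E} [IsProbabilityMeasure μ]
  {Ω : Type*} [MeasurableSpace Ω] {P : Measure Ω} [IsProbabilityMeasure P] {X : ℕ → Ω → E}

/-- The expected transport cost is bounded by the sum over the shells of a countable partition of
the expected cost inside the shell and the expected fluctuation of the mass of the shell. -/
lemma lintegral_transportCost_le_tsum (hD : 0 < D) (hr : 1 < r)
    (hQ : HasNestedPartitions E d A D r) (hXm : ∀ k, Measurable (X k)) (hXindep : iIndepFun X P)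
    (hXlaw : ∀ k, P.map (X k) = μ) {p : ℝ} (hp : 0 < p) {N : ℕ} (hN : 1 ≤ N)
    {G : ℕ → Set E} (hG : ∀ n, MeasurableSet (G n)) (hGd : Pairwise (Function.onFun Disjoint G))
    (hGu : ⋃ n, G n = Set.univ) {ρ : ℕ → ℝ} (hρ0 : ∀ n, 0 < ρ n)
    (hGρ : ∀ n, G n ⊆ Metric.ball 0 (ρ n)) (k : ℕ → ℕ) :
    ∫⁻ ω, transportCost p (empiricalMeasure N (fun k => X k ω)) μ ∂P ≤
      ∑' n, (ENNReal.ofReal (ρ n ^ p * (D ^ p * depthCost d A r p N (μ.real (G n)) (k n))) +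
        ENNReal.ofReal (2 ^ p * epsConst p * ρ n ^ p) * ∫⁻ ω, ENNReal.ofReal
          |(empiricalMeasure N fun k => X k ω).real (G n) - μ.real (G n)| ∂P) := by
  have hr0 : 0 < r := by linarith
  choose S c hSc hcard hdiam using fun n =>
    hQ.exists_isNestedPartition (hρ0 n) (hG n) (hGρ n) (k n)
  have ht0 : 0 ≤ r ^ (-p) := by positivity
  have ht1 : r ^ (-p) ≤ 1 := Real.rpow_le_one_of_one_le_of_nonpos hr.le (by linarith)
  have hcost : ∀ n, ∀ ℓ ≤ k n, ∀ i ∈ S n ℓ, ∀ x ∈ c n i, ∀ y ∈ c n i,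
      ENNReal.ofReal (‖x - y‖ ^ p) ≤ ENNReal.ofReal ((ρ n * D) ^ p * (r ^ (-p)) ^ ℓ) := by
    intro n ℓ hℓ i hi x hx y hy
    refine ENNReal.ofReal_le_ofReal ?_
    calc ‖x - y‖ ^ p ≤ (ρ n * (D * (r ^ ℓ)⁻¹)) ^ p :=
          Real.rpow_le_rpow (norm_nonneg _) (hdiam n ℓ hℓ i hi x hx y hy) hp.le
      _ = _ := by
        have := hρ0 n
        rw [← mul_assoc, Real.mul_rpow (by positivity) (by positivity), Real.inv_rpow (by positivity),
          ← Real.rpow_natCast, ← Real.rpow_natCast, ← Real.rpow_mul hr0.le, ← Real.rpow_mul hr0.le,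
          ← Real.rpow_neg hr0.le]
        congr 2
        ring
  set Y : ℕ → Ω → ℝ≥0∞ := fun n ω => ENNReal.ofReal ((ρ n * D) ^ p * ((r ^ (-p)) ^ k n *
    μ.real (G n) + (1 - r ^ (-p)) * ∑ ℓ ∈ Finset.range (k n), (r ^ (-p)) ^ ℓ * min (μ.real (G n))
      ((∑ i ∈ S n (ℓ + 1), |(empiricalMeasure N fun k => X k ω).real (c n i) -
        μ.real (c n i)|) / 2))) with hY
  set Z : ℕ → Ω → ℝ≥0∞ := fun n ω => ENNReal.ofReal (2 ^ p * epsConst p * ρ n ^ p *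
    |(empiricalMeasure N fun k => X k ω).real (G n) - μ.real (G n)|) with hZ
  have hYm : ∀ n, Measurable (Y n) := fun n => (hSc n).measurable_cost hXm μ N _ _
  have hZm : ∀ n, Measurable (Z n) := fun n =>
    ((((measurable_empiricalMeasure_real hXm N (hG n)).sub_const _).abs).const_mul _).ennreal_ofReal
  have hpt : ∀ ω, transportCost p (empiricalMeasure N (fun k => X k ω)) μ ≤
      ∑' n, (Y n ω + Z n ω) := by
    intro ω
    have := isProbabilityMeasure_empiricalMeasure hN fun k => X k ω
    choose ξ h1 h2 h3 h4 using fun n => (hSc n).exists_partialCoupling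
      (empiricalMeasure N (fun k => X k ω)) μ (fun z => ENNReal.ofReal (‖z.1 - z.2‖ ^ p))
      (W := (ρ n * D) ^ p) (have := hρ0 n; by positivity) ht0 ht1 (hcost n)
    refine (transportCost_le_tsum hp _ μ hG hGd hGu
      (fun n x hx => (mem_ball_zero_iff.1 (hGρ n hx)).le) ξ h1 h2 h3).trans ?_
    refine ENNReal.tsum_le_tsum fun n => ?_
    rw [hZ, two_rpow_mul_epsConst]
    exact add_le_add_left (h4 n) _
  calc _ ≤ ∫⁻ ω, ∑' n, (Y n ω + Z n ω) ∂P := lintegral_mono hpt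
    _ = ∑' n, (∫⁻ ω, Y n ω ∂P + ∫⁻ ω, Z n ω ∂P) := by
        rw [lintegral_tsum (f := fun n ω => Y n ω + Z n ω)
          fun n => ((hYm n).add (hZm n)).aemeasurable]
        simp_rw [lintegral_add_left (hYm _)]
    _ ≤ _ := by
        have heps : 0 ≤ epsConst p := le_max_of_le_left (by norm_num)
        refine ENNReal.tsum_le_tsum fun n => add_le_add ?_ (le_of_eq ?_)
        · have := hρ0 n
          refine ((hSc n).lintegral_cost_le hXm hXindep hXlaw hN (by positivity) ht0 ht1
            (hcard n)).trans (le_of_eq ?_)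
          rw [depthCost, Real.mul_rpow (by positivity) hD.le, mul_assoc]
        · have := hρ0 n
          rw [← lintegral_const_mul' _ _ ENNReal.ofReal_ne_top]
          refine lintegral_congr fun ω => ?_
          exact ENNReal.ofReal_mul (by positivity)

end Summation

/-! ### Optimisation of the radii and conclusion -/

section Conclusion

/-- Summation of a sequence dominated by a geometric one from its second term on. -/
lemma tsum_le_ofReal_of_geometric {f : ℕ → ℝ≥0∞} {a b g : ℝ} (ha : 0 ≤ a) (hb : 0 ≤ b)
    (hg0 : 0 ≤ g) (hg1 : g < 1) (h0 : f 0 ≤ ENNReal.ofReal a)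
    (hf : ∀ n, f (n + 1) ≤ ENNReal.ofReal (b * g ^ n)) :
    ∑' n, f n ≤ ENNReal.ofReal (a + b * (1 - g)⁻¹) := by
  have h1 : 0 < 1 - g := sub_pos.2 hg1
  rw [tsum_eq_zero_add' ENNReal.summable, ENNReal.ofReal_add ha (by positivity)]
  refine add_le_add h0 ((ENNReal.tsum_le_tsum hf).trans (le_of_eq ?_))
  rw [← ENNReal.ofReal_tsum_of_nonneg (fun n => by positivity)
    ((summable_geometric_of_lt_one hg0 hg1).mul_left b), tsum_mul_left,
    tsum_geometric_of_lt_one hg0 hg1]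

/-- Minimisation over the radius `R` of the central ball. -/
lemma le_of_forall_radius {T : ℝ≥0∞} {p s q M κ x : ℝ} (hp : 0 < p) (hs : 0 < s) (hsq : s < q)
    (hM : 0 ≤ M) (hx : 0 ≤ x)
    (h : ∀ R : ℝ, 0 < R → T ≤ ENNReal.ofReal ((2 : ℝ) ^ p * κ * (R ^ p * (1 + (M * R ^ (-q)) ^ (p / s)
      * (x + (1 + x) * (q / s) ^ (q / (q - s)) * (s / (q - s))))))) :
    T ≤ ENNReal.ofReal ((2 : ℝ) ^ p * κ * M ^ (p / q) * constH x s q) := by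
  have hq : 0 < q := hs.trans hsq
  have hqs : 0 < q - s := sub_pos.2 hsq
  set L := (q / s) ^ (q / (q - s)) with hL
  have hL0 : 0 < L := by positivity
  set I := x * ((q - s) / s) + (1 + x) * L with hI
  have hI0 : 0 < I := by positivity
  have hW : x + (1 + x) * L * (s / (q - s)) = I * (s / (q - s)) := by
    rw [hI]; field_simp
  rw [hW] at h
  rcases hM.eq_or_lt with rfl | hM
  · have hzero : (0 : ℝ) ^ (p / s) = 0 := Real.zero_rpow (by positivity)
    have hzero' : (0 : ℝ) ^ (p / q) = 0 := Real.zero_rpow (by positivity)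
    simp only [zero_mul, hzero, add_zero, mul_one] at h
    rw [hzero', mul_zero, zero_mul]
    -- With zero moment there is no optimal radius; `R` tends to zero instead.
    have hlim : Filter.Tendsto (fun R : ℝ => ENNReal.ofReal ((2 : ℝ) ^ p * κ * R ^ p))
        (nhdsWithin 0 (Set.Ioi 0)) (nhds (ENNReal.ofReal 0)) := by
      refine ENNReal.tendsto_ofReal ?_
      have : Filter.Tendsto (fun R : ℝ => (2 : ℝ) ^ p * κ * R ^ p) (nhds 0)
          (nhds ((2 : ℝ) ^ p * κ * 0 ^ p)) :=
        (Real.continuousAt_rpow_const 0 p (Or.inr hp.le)).tendsto.const_mul _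
      rw [Real.zero_rpow hp.ne', mul_zero] at this
      exact this.mono_left nhdsWithin_le_nhds
    exact ge_of_tendsto hlim (Filter.eventually_of_mem self_mem_nhdsWithin fun R hR => h R hR)
  · set Y := M ^ (p / s) * I with hY
    have hY0 : 0 < Y := by positivity
    have hYR : (Y ^ (s / (p * q))) ^ p = Y ^ (s / q) := by
      rw [← Real.rpow_mul hY0.le]; congr 1; field_simp
    have hYq : (Y ^ (s / (p * q))) ^ (-q * (p / s)) = Y⁻¹ := by
      rw [← Real.rpow_mul hY0.le, ← Real.rpow_neg_one]; congr 1; field_simp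
    have hMq : Y ^ (s / q) = M ^ (p / q) * I ^ (s / q) := by
      rw [hY, Real.mul_rpow (by positivity) hI0.le, ← Real.rpow_mul hM.le]
      congr 2
      field_simp
    -- The derivative in `R` vanishes when `R ^ (q * p / s) = Y`; the bracket then equals `1 + s /
    -- (q - s) = q / (q - s)`.
    refine (h (Y ^ (s / (p * q))) (by positivity)).trans (le_of_eq ?_)
    rw [Real.mul_rpow hM.le (by positivity), ← Real.rpow_mul
      (show 0 ≤ Y ^ (s / (p * q)) by positivity), hYR, hYq, constH,
      ← hL, ← hI, hMq]
    have e : M ^ (p / s) * Y⁻¹ * (I * (s / (q - s))) = s / (q - s) := by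
      rw [hY]; field_simp
    rw [e]
    congr 1
    field_simp
    ring

variable {E : Type*} [NormedAddCommGroup E] [NormedSpace ℝ E]
  [MeasurableSpace E] [BorelSpace E] {d : ℕ} {A D r : ℝ} {μ : Measure E} [IsProbabilityMeasure μ]
  {Ω : Type*} [MeasurableSpace Ω] {P : Measure Ω} [IsProbabilityMeasure P] {X : ℕ → Ω → E}

lemma lintegral_transportCost_le_radius (hD : 0 < D) (hr : 1 < r)
    (hQ : HasNestedPartitions E d A D r) (hXm : ∀ k, Measurable (X k)) (hXindep : iIndepFun X P)
    (hXlaw : ∀ k, P.map (X k) = μ) {p q s : ℝ} (hp : 0 < p) (hs : 0 < s) (hsq : s < q)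
    (hM : absMoment q μ < ∞) {N : ℕ} (hN : 1 ≤ N) {κ δ : ℝ} (hκ : 0 ≤ κ) (hδ : 0 ≤ δ)
    (hdepth : ∀ u : ℝ, 0 ≤ u → u ≤ 1 →
      ∃ k, D ^ p * depthCost d A r p N u k ≤ (2 : ℝ) ^ p * κ * u ^ (p / s))
    (hfluct : ∀ u : ℝ, 0 ≤ u → u ≤ 1 → min (2 * u) (√(u / N)) ≤ δ * u ^ (p / s))
    {R : ℝ} (hR : 0 < R) :
    ∫⁻ ω, transportCost p (empiricalMeasure N (fun k => X k ω)) μ ∂P ≤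
      ENNReal.ofReal ((2 : ℝ) ^ p * R ^ p * (κ + ((absMoment q μ).toReal * R ^ (-q)) ^ (p / s) *
        (epsConst p * δ + (κ + epsConst p * δ) * (q / s) ^ (q / (q - s)) * (s / (q - s))))) := by
  have hq : 0 < q := hs.trans hsq
  have hqs : 0 < q - s := sub_pos.2 hsq
  set τ := p / s with hτ
  have hτ0 : 0 < τ := by positivity
  set M := (absMoment q μ).toReal with hMdef
  have hM0 : 0 ≤ M := ENNReal.toReal_nonneg
  have heps : 0 < epsConst p := lt_max_of_lt_left (by norm_num)
  have hexp : 0 < q * τ - p := by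
    have : q * τ - p = p * (q - s) / s := by rw [hτ]; field_simp
    rw [this]; positivity
  have hqs1 : 1 < q / s := by rwa [one_lt_div hs]
  -- This ratio of radii minimises `c ^ p / (1 - c ^ (p - q * τ))`, the factor from the geometric
  -- series; at the minimum the series has ratio `s / q`.
  set c := (q / s) ^ (1 / (q * τ - p)) with hc
  have hc1 : 1 < c := Real.one_lt_rpow hqs1 (by positivity)
  have hc0 : 0 < c := by linarith
  have hcL : c ^ (q * τ) = (q / s) ^ (q / (q - s)) := by
    rw [hc, ← Real.rpow_mul (by positivity)]
    congr 1
    rw [hτ]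
    have : q * (p / s) - p = p * (q - s) / s := by field_simp
    rw [this]
    field_simp
  have hcg : c ^ (p - q * τ) = s / q := by
    rw [hc, ← Real.rpow_mul (by positivity), show 1 / (q * τ - p) * (p - q * τ) = -1 by
      field_simp; ring, Real.rpow_neg_one, inv_div]
  set ρ : ℕ → ℝ := fun n => R * c ^ n with hρ
  have hρ0 : ∀ n, 0 < ρ n := fun n => by positivity
  have hmono : Monotone fun n => Metric.ball (0 : E) (ρ n) := fun m n hmn =>
    Metric.ball_subset_ball (mul_le_mul_of_nonneg_left (pow_le_pow_right₀ hc1.le hmn) hR.le)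
  set G : ℕ → Set E := disjointed fun n => Metric.ball (0 : E) (ρ n) with hG
  have hGm : ∀ n, MeasurableSet (G n) := fun n =>
    MeasurableSet.disjointed (fun _ => Metric.isOpen_ball.measurableSet) n
  have hGu : ⋃ n, G n = Set.univ := by
    rw [hG, iUnion_disjointed, Set.eq_univ_iff_forall]
    intro x
    obtain ⟨n, hn⟩ := pow_unbounded_of_one_lt (‖x‖ / R) hc1
    refine Set.mem_iUnion.2 ⟨n, ?_⟩
    rw [mem_ball_zero_iff]
    rwa [div_lt_iff₀ hR, mul_comm] at hn
  have hG0 : G 0 = Metric.ball 0 R := by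
    rw [hG, disjointed_zero, hρ]; simp
  have htail : ∀ n, μ.real (Metric.ball 0 (ρ n))ᶜ ≤ M * R ^ (-q) * (c ^ (-q)) ^ n := by
    intro n
    refine (measureReal_compl_ball_le hq hM (hρ0 n)).trans (le_of_eq ?_)
    rw [hρ, Real.mul_rpow hR.le (by positivity), ← Real.rpow_natCast, ← Real.rpow_natCast,
      ← Real.rpow_mul hc0.le, ← Real.rpow_mul hc0.le, mul_comm (n : ℝ), mul_assoc]
  have hGsucc : ∀ n, μ.real (G (n + 1)) ≤ M * R ^ (-q) * (c ^ (-q)) ^ n := by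
    intro n
    have h : G (n + 1) = Metric.ball 0 (ρ (n + 1)) \ Metric.ball 0 (ρ n) :=
      hmono.disjointed_succ (not_isMax n)
    rw [h]
    exact (measureReal_mono fun x hx => hx.2).trans (htail n)
  have hfl : ∀ C : Set E, MeasurableSet C → ∫⁻ ω, ENNReal.ofReal
      |(empiricalMeasure N fun k => X k ω).real C - μ.real C| ∂P ≤
        ENNReal.ofReal (δ * μ.real C ^ τ) := by
    intro C hC
    refine le_trans ?_ (ENNReal.ofReal_le_ofReal (hfluct _ measureReal_nonneg measureReal_le_one))
    rw [ENNReal.ofReal_min]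
    exact le_min (lintegral_abs_empiricalMeasure_sub_le_two_mul hXm hXlaw hN hC)
      (lintegral_abs_empiricalMeasure_sub_le hXm hXindep hXlaw hN hC)
  choose k hk using fun n => hdepth (μ.real (G n)) measureReal_nonneg measureReal_le_one
  set m := M * R ^ (-q) with hm
  have hm0 : 0 ≤ m := by positivity
  refine (lintegral_transportCost_le_tsum hD hr hQ hXm hXindep hXlaw hp hN hGm
    (disjoint_disjointed _) hGu hρ0 (fun n => disjointed_subset _ n) k).trans ?_
  refine (tsum_le_ofReal_of_geometric (a := 2 ^ p * R ^ p * (κ + epsConst p * δ * m ^ τ))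
    (b := 2 ^ p * R ^ p * (κ + epsConst p * δ) * m ^ τ * c ^ p) (g := s / q) (by positivity)
    (by positivity) (by positivity) (by rwa [div_lt_one hq]) ?_ ?_).trans (le_of_eq ?_)
  · have h0 : ∫⁻ ω, ENNReal.ofReal |(empiricalMeasure N fun k => X k ω).real (G 0) -
        μ.real (G 0)| ∂P ≤ ENNReal.ofReal (δ * m ^ τ) := by
      -- The central ball and its complement have the same fluctuation, and the complement has small
      -- mass by Markov's inequality.
      calc _ = ∫⁻ ω, ENNReal.ofReal |(empiricalMeasure N fun k => X k ω).real (G 0)ᶜ -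
            μ.real (G 0)ᶜ| ∂P := by
            refine lintegral_congr fun ω => ?_
            have := isProbabilityMeasure_empiricalMeasure hN fun k => X k ω
            rw [probReal_compl_eq_one_sub (hGm 0), probReal_compl_eq_one_sub (hGm 0),
              sub_sub_sub_cancel_left, abs_sub_comm]
        _ ≤ ENNReal.ofReal (δ * μ.real (G 0)ᶜ ^ τ) := hfl _ (hGm 0).compl
        _ ≤ _ := by
            gcongr
            have := htail 0
            rw [pow_zero, mul_one] at this
            rw [hG0]
            simpa [hρ] using this
    calc _ ≤ ENNReal.ofReal (R ^ p * (2 ^ p * κ * 1)) + ENNReal.ofReal (2 ^ p * epsConst p * R ^ p)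
          * ENNReal.ofReal (δ * m ^ τ) := by
          have hρR : ρ 0 = R := by simp [hρ]
          rw [hρR]
          refine add_le_add (ENNReal.ofReal_le_ofReal (mul_le_mul_of_nonneg_left ?_
            (by positivity))) (mul_le_mul' le_rfl h0)
          refine (hk 0).trans ?_
          gcongr
          exact Real.rpow_le_one measureReal_nonneg measureReal_le_one hτ0.le
      _ = _ := by
          rw [← ENNReal.ofReal_mul (by positivity), ← ENNReal.ofReal_add (by positivity)
            (by positivity)]
          congr 1
          ring
  · intro n
    set w := m * (c ^ (-q)) ^ n with hw
    have hw0 : 0 ≤ w := by positivity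
    have hwτ : (c ^ (n + 1)) ^ p * w ^ τ = m ^ τ * c ^ p * (s / q) ^ n := by
      rw [hw, Real.mul_rpow hm0 (by positivity), ← hcg, ← Real.rpow_natCast, ← Real.rpow_natCast,
        ← Real.rpow_natCast, ← Real.rpow_mul hc0.le, ← Real.rpow_mul hc0.le,
        ← Real.rpow_mul hc0.le, ← Real.rpow_mul hc0.le]
      have : c ^ (((n + 1 : ℕ) : ℝ) * p) * c ^ (-q * n * τ) = c ^ p * c ^ ((p - q * τ) * n) := by
        rw [← Real.rpow_add hc0, ← Real.rpow_add hc0]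
        congr 1
        push_cast
        ring
      calc _ = m ^ τ * (c ^ (((n + 1 : ℕ) : ℝ) * p) * c ^ (-q * n * τ)) := by ring
        _ = _ := by rw [this]; ring
    have hu : μ.real (G (n + 1)) ^ τ ≤ w ^ τ :=
      Real.rpow_le_rpow measureReal_nonneg (hGsucc n) hτ0.le
    have hρp : ρ (n + 1) ^ p = R ^ p * (c ^ (n + 1)) ^ p :=
      Real.mul_rpow hR.le (by positivity)
    calc _ ≤ ENNReal.ofReal (ρ (n + 1) ^ p * (2 ^ p * κ * w ^ τ)) +
          ENNReal.ofReal (2 ^ p * epsConst p * ρ (n + 1) ^ p) * ENNReal.ofReal (δ * w ^ τ) := by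
          have := hρ0 (n + 1)
          refine add_le_add (ENNReal.ofReal_le_ofReal (mul_le_mul_of_nonneg_left ?_
            (by positivity))) (mul_le_mul' le_rfl ?_)
          · refine (hk (n + 1)).trans ?_
            gcongr
          · refine (hfl _ (hGm (n + 1))).trans (ENNReal.ofReal_le_ofReal ?_)
            gcongr
      _ = _ := by
          have := hρ0 (n + 1)
          rw [← ENNReal.ofReal_mul (by positivity), ← ENNReal.ofReal_add (by positivity)
            (by positivity), hρp]
          congr 1
          calc _ = 2 ^ p * R ^ p * (κ + epsConst p * δ) * ((c ^ (n + 1)) ^ p * w ^ τ) := by ring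
            _ = _ := by rw [hwτ]; ring
  · congr 1
    have hgs : (1 - s / q)⁻¹ = q / (q - s) := by field_simp
    have hcp : c ^ p = (q / s) ^ (q / (q - s)) * (s / q) := by
      rw [← hcL, ← hcg, ← Real.rpow_add hc0]
      congr 1
      ring
    rw [hgs, hcp]
    field_simp
    ring

theorem lintegral_transportCost_le (hD : 0 < D) (hr : 1 < r)
    (hQ : HasNestedPartitions E d A D r) (hXm : ∀ k, Measurable (X k)) (hXindep : iIndepFun X P)
    (hXlaw : ∀ k, P.map (X k) = μ) {p q s : ℝ} (hp : 0 < p) (hs : 0 < s) (hsq : s < q)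
    (hM : absMoment q μ < ∞) {N : ℕ} (hN : 1 ≤ N) {κ δ : ℝ} (hκ : 0 < κ) (hδ : 0 ≤ δ)
    (hdepth : ∀ u : ℝ, 0 ≤ u → u ≤ 1 →
      ∃ k, D ^ p * depthCost d A r p N u k ≤ (2 : ℝ) ^ p * κ * u ^ (p / s))
    (hfluct : ∀ u : ℝ, 0 ≤ u → u ≤ 1 → min (2 * u) (√(u / N)) ≤ δ * u ^ (p / s)) :
    ∫⁻ ω, transportCost p (empiricalMeasure N (fun k => X k ω)) μ ∂P ≤
      ENNReal.ofReal ((2 : ℝ) ^ p * κ * (absMoment q μ).toReal ^ (p / q) *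
        constH (epsConst p * δ / κ) s q) := by
  have heps : 0 < epsConst p := lt_max_of_lt_left (by norm_num)
  refine le_of_forall_radius hp hs hsq ENNReal.toReal_nonneg (by positivity) fun R hR => ?_
  refine (lintegral_transportCost_le_radius hD hr hQ hXm hXindep hXlaw hp hs hsq hM hN hκ.le hδ
    hdepth hfluct hR).trans (le_of_eq ?_)
  congr 1
  have : epsConst p * δ + (κ + epsConst p * δ) * (q / s) ^ (q / (q - s)) * (s / (q - s)) =
      κ * (epsConst p * δ / κ + (1 + epsConst p * δ / κ) * (q / s) ^ (q / (q - s)) *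
        (s / (q - s))) := by
    field_simp
  rw [this]
  ring

end Conclusion

/-! ### Positivity of the constants and interpolation of the fluctuation bounds -/

section Constants

variable {d N : ℕ} {A D r p u : ℝ}

lemma kappaHigh_pos (hA : 0 < A) (hD : 0 < D) (hr : 1 < r) (hdp : (d : ℝ) / 2 < p) :
    0 < kappaHigh d A D r p := by
  have hr0 : 0 < r := by linarith
  have : 0 < 1 - r ^ ((d : ℝ) / 2 - p) :=
    sub_pos.2 (Real.rpow_lt_one_of_one_lt_of_neg hr (by linarith))
  rw [kappaHigh]
  positivity

lemma kappaCritical_pos (hA : 0 < A) (hD : 0 < D) (hr : 1 < r) (hp : 0 < p) :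
    0 < kappaCritical A D r p N := by
  have hr0 : 0 < r := by linarith
  have h1 : 0 < r ^ p - 1 := sub_pos.2 (Real.one_lt_rpow hr hp)
  have h2 : 0 < Real.log r := Real.log_pos hr
  refine add_pos_of_nonneg_of_pos (mul_nonneg (by positivity) Real.posLog_nonneg) (by positivity)

lemma kappaLow_pos (hA : 0 < A) (hD : 0 < D) (hr : 1 < r) (hp : 0 < p) (hdp : p < (d : ℝ) / 2) :
    0 < kappaLow d A D r p := by
  have hr0 : 0 < r := by linarith
  have h1 : 0 < r ^ ((d : ℝ) / 2) - 1 := sub_pos.2 (Real.one_lt_rpow hr (hp.trans hdp))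
  have h2 : 0 < r ^ ((d : ℝ) / 2 - p) - 1 := sub_pos.2 (Real.one_lt_rpow hr (sub_pos.2 hdp))
  rw [kappaLow]
  positivity

lemma min_two_mul_sqrt_le (hu : 0 ≤ u) :
    min (2 * u) (√(u / N)) ≤ 1 / √(N : ℝ) * u ^ (1 / 2 : ℝ) := by
  refine (min_le_right _ _).trans (le_of_eq ?_)
  rw [Real.sqrt_div hu, Real.sqrt_eq_rpow u]
  ring

/-- Geometric interpolation between the two bounds, with weights `1 - 2θ` and `2θ`. -/
lemma min_two_mul_sqrt_le_rpow (hu : 0 ≤ u) {θ : ℝ} (hθ0 : 0 < θ) (hθ1 : θ < 1 / 2) :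
    min (2 * u) (√(u / N)) ≤
      (2 : ℝ) ^ (1 - 2 * θ) / (N : ℝ) ^ θ * u ^ (1 - θ) := by
  rcases hu.eq_or_lt with rfl | hu
  · rw [Real.zero_rpow (by linarith)]; simp
  set m := min (2 * u) (√(u / N)) with hm
  have hm0 : 0 ≤ m := le_min (by positivity) (by positivity)
  calc m = m ^ (1 - 2 * θ) * m ^ (2 * θ) := by
        rw [← Real.rpow_add' hm0 (by norm_num), sub_add_cancel, Real.rpow_one]
    _ ≤ (2 * u) ^ (1 - 2 * θ) * (√(u / N)) ^ (2 * θ) := by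
        refine mul_le_mul (Real.rpow_le_rpow hm0 (min_le_left _ _) (by linarith))
          (Real.rpow_le_rpow hm0 (min_le_right _ _) (by linarith)) (by positivity) (by positivity)
    _ = _ := by
        rw [Real.mul_rpow zero_le_two hu.le, Real.sqrt_eq_rpow, ← Real.rpow_mul (by positivity),
          show 1 / 2 * (2 * θ) = θ by ring, Real.div_rpow hu.le (by positivity),
          show 1 - θ = (1 - 2 * θ) + θ by ring, Real.rpow_add hu]
        ring

end Constants

theorem mainTheorem3
    {E : Type*} [NormedAddCommGroup E] [NormedSpace ℝ E] [FiniteDimensional ℝ E]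
    [MeasurableSpace E] [BorelSpace E]
    (d : ℕ) (hd : 1 ≤ d) (hdim : Module.finrank ℝ E = d)
    (A D r : ℝ) (hA : 0 < A) (hD : 0 < D) (hr : 1 < r)
    (hQ : HasNestedPartitions E d A D r)
    (μ : Measure E) [IsProbabilityMeasure μ]
    {Ω : Type*} [MeasurableSpace Ω] (P : Measure Ω) [IsProbabilityMeasure P]
    (X : ℕ → Ω → E) (hXm : ∀ k, Measurable (X k)) (hXindep : iIndepFun X P)
    (hXlaw : ∀ k, P.map (X k) = μ)
    (p q : ℝ) (hp : 0 < p) (hpq : p < q) (hM : absMoment q μ < ∞) :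
    (∀ N : ℕ, 1 ≤ N →
      AEMeasurable (fun ω => transportCost p (empiricalMeasure N (fun k => X k ω)) μ) P) ∧
    ((d : ℝ) / 2 < p → 2 * p < q → ∀ N : ℕ, 1 ≤ N →
      ∫⁻ ω, transportCost p (empiricalMeasure N (fun k => X k ω)) μ ∂P ≤
        ENNReal.ofReal ((2 : ℝ) ^ p * (kappaHigh d A D r p / √(N : ℝ))
          * (absMoment q μ).toReal ^ (p / q)
          * constH (epsConst p / kappaHigh d A D r p) (2 * p) q)) ∧
    (p = (d : ℝ) / 2 → 2 * p < q → ∀ N : ℕ, 1 ≤ N →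
      ∫⁻ ω, transportCost p (empiricalMeasure N (fun k => X k ω)) μ ∂P ≤
        ENNReal.ofReal ((2 : ℝ) ^ p * (kappaCritical A D r p N / √(N : ℝ))
          * (absMoment q μ).toReal ^ (p / q)
          * constH (epsConst p / kappaCritical A D r p N) (2 * p) q)) ∧
    (p < (d : ℝ) / 2 → (d : ℝ) * p / ((d : ℝ) - p) < q → ∀ N : ℕ, 1 ≤ N →
      ∫⁻ ω, transportCost p (empiricalMeasure N (fun k => X k ω)) μ ∂P ≤
        ENNReal.ofReal ((2 : ℝ) ^ p * (kappaLow d A D r p / (N : ℝ) ^ (p / d))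
          * (absMoment q μ).toReal ^ (p / q)
          * constH ((2 : ℝ) ^ (1 - 2 * p / d) * epsConst p / kappaLow d A D r p)
              ((d : ℝ) * p / ((d : ℝ) - p)) q)) := by

  -- Properness supplies the completeness and second countability needed for disintegration and
  -- measurability.
  have hproper : ProperSpace E := FiniteDimensional.proper ℝ E
  refine ⟨fun N hN => ?_, fun hdp hq N hN => ?_, fun hdp hq N hN => ?_, fun hdp hq N hN => ?_⟩
  · exact ((measurable_transportCost_empiricalMeasure hp hN μ
      (absMoment_lt_top_of_le hp.le hpq.le μ hM)).comp
      (measurable_pi_lambda (fun ω k => X k ω) hXm)).aemeasurable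
  · have hN0 : (0 : ℝ) < √(N : ℝ) := Real.sqrt_pos.2 (by exact_mod_cast hN)
    have hκ : 0 < kappaHigh d A D r p := kappaHigh_pos hA hD hr hdp
    -- The moment exponent `s = 2p` is the one for which `u ^ (p/s)` is `√u`.
    have hτ : p / (2 * p) = 1 / 2 := by field_simp
    have h := lintegral_transportCost_le (s := 2 * p) (κ := kappaHigh d A D r p / √(N : ℝ))
      (δ := 1 / √(N : ℝ)) hD hr hQ hXm hXindep hXlaw hp (by positivity) hq hM hN (by positivity)
      (by positivity)
      (fun u hu _ => by rw [hτ]; exact exists_depthCost_le_high hA hD hr hp hN hdp hu)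
      (fun u hu _ => by rw [hτ]; exact min_two_mul_sqrt_le hu)
    -- The rate in `N` is common to `κ` and `δ`, so it cancels in the first argument of `constH`.
    rwa [mul_one_div, div_div_div_cancel_right₀ hN0.ne'] at h
  · have hN0 : (0 : ℝ) < √(N : ℝ) := Real.sqrt_pos.2 (by exact_mod_cast hN)
    have hκ : 0 < kappaCritical A D r p N := kappaCritical_pos hA hD hr hp
    have hτ : p / (2 * p) = 1 / 2 := by field_simp
    have h := lintegral_transportCost_le (s := 2 * p) (κ := kappaCritical A D r p N / √(N : ℝ))
      (δ := 1 / √(N : ℝ)) hD hr hQ hXm hXindep hXlaw hp (by positivity) hq hM hN (by positivity)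
      (by positivity)
      (fun u hu hu1 => by rw [hτ]; exact exists_depthCost_le_critical hA hD hr hp hN hdp hu hu1)
      (fun u hu _ => by rw [hτ]; exact min_two_mul_sqrt_le hu)
    rwa [mul_one_div, div_div_div_cancel_right₀ hN0.ne'] at h
  · have hN0 : (0 : ℝ) < (N : ℝ) ^ (p / d) :=
      Real.rpow_pos_of_pos (by exact_mod_cast hN) _
    have hd0 : (0 : ℝ) < d := by exact_mod_cast hd
    have hdp0 : (0 : ℝ) < d - p := by linarith
    have hκ : 0 < kappaLow d A D r p := kappaLow_pos hA hD hr hp hdp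
    -- Here `s` is chosen so that `p / s` matches the exponent `1 - p/d` of the depth bound.
    have hτ : p / ((d : ℝ) * p / ((d : ℝ) - p)) = 1 - p / d := by field_simp
    have hθ : 2 * p / (d : ℝ) = 2 * (p / d) := mul_div_assoc _ _ _
    have h := lintegral_transportCost_le (s := (d : ℝ) * p / ((d : ℝ) - p))
      (κ := kappaLow d A D r p / (N : ℝ) ^ (p / d))
      (δ := (2 : ℝ) ^ (1 - 2 * p / d) / (N : ℝ) ^ (p / d)) hD hr hQ hXm hXindep hXlaw hp
      (by positivity) hq hM hN (by positivity) (by positivity)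
      (fun u hu _ => by rw [hτ]; exact exists_depthCost_le_low hA hD hr hp hN hdp hu)
      (fun u hu _ => by
        rw [hτ, hθ]
        exact min_two_mul_sqrt_le_rpow hu (by positivity) (by rw [div_lt_iff₀ hd0]; linarith))
    rwa [← mul_div_assoc (epsConst p), div_div_div_cancel_right₀ hN0.ne', mul_comm (epsConst p)] at h
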